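/- Let $\mathcal{C}$ be a regular Mal'cev category, i.e. a regular category in which every reflexive relation $R \rightarrowtail A \times A$ is an equivalence relation. Let $\mathrm{Rel}(\mathcal{C})$ be the dagger monoidal category with the same objects as $\mathcal{C}$, whose morphisms $A \to B$ are the subobjects $R \rightarrowtail A \times B$ in $\mathcal{C}$, with composition $S \circ R$ given by the image in $A \times C$ of the pullback $R \times_B S$, identities the diagonals, tensor product $\otimes$ induced by the product of $\mathcal{C}$ (with unit $I$ the terminal object), and dagger $R^\dagger$ the opposite relation. For an object $A$ and morphisms $\mu \colon A \otimes A \to A$ and $\eta \colon I \to A$ in $\mathrm{Rel}(\mathcal{C})$, the following are equivalent: 1. $\mu$ and $\eta$ satisfy the unit laws $\mu \circ (\eta \otimes 1_A) = 1_A = \mu \circ (1_A \otimes \eta)$ (up to the unit isomorphisms); 2. $\mu$ and $\eta$ are the composition and identities of an internal category in $\mathcal{C}$: there is an internal category $(U, A, s, t, u, m)$ in $\mathcal{C}$, with object of morphisms $A$, such that $\mu$ is the subobject $A \times_U A \rightarrowtail (A \times A) \times A$ given by the inclusion of composable pairs together with $m$, and $\eta$ is the subobject $u \colon U \rightarrowtail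 A$; 3. $\mu$ and $\eta$ are, in the same sense, the composition and identities of an internal groupoid in $\mathcal{C}$; 4. $(A, \mu, \eta)$ is a special dagger Frobenius structure in $\mathrm{Rel}(\mathcal{C})$: besides the unit laws it satisfies associativity $\mu \circ (\mu \otimes 1_A) = \mu \circ (1_A \otimes \mu)$, speciality $\mu \circ \mu^\dagger = 1_A$ and the Frobenius law $(\mu \otimes 1_A) \circ (1_A \otimes \mu^\dagger) = (1_A \otimes \mu) \circ (\mu^\dagger \otimes 1_A)$ (up to the associativity isomorphisms). In particular, any $\mu$, $\eta$ satisfying only the unit laws already form an internal category, hence groupoid, and a special dagger Frobenius structure. -/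

import Mathlib

open CategoryTheory CategoryTheory.Limits MonoidalCategory CartesianMonoidalCategory

universe v u

-- Makes `X ⟶ Y` elaborate to the morphisms of the category itself, not of its reflexive quiver.
attribute [local instance 2000] CategoryStruct.toQuiver

/-- A category is a Mal'cev category when every reflexive relation `(p₁, p₂) : R ↣ A × A`
is an equivalence relation. (Finite limits are assumed separately, through regularity.) -/
def IsMalcev (C : Type u) [Category.{v} C] : Prop :=
  ∀ ⦃R A : C⦄ (p₁ p₂ : R ⟶ A), Nonempty (ReflexiveRelation p₁ p₂) → IsEquivalenceRelation p₁ p₂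

/-! ### Special dagger Frobenius structures in a dagger monoidal category -/

/-- A dagger category: an identity-on-objects contravariant involution. -/
class DaggerCategory (D : Type u) [Category.{v} D] where
  /-- the dagger of a morphism -/
  dagger : ∀ {X Y : D}, (X ⟶ Y) → (Y ⟶ X)
  dagger_dagger : ∀ {X Y : D} (f : X ⟶ Y), dagger (dagger f) = f
  dagger_id : ∀ X : D, dagger (𝟙 X) = 𝟙 X
  dagger_comp : ∀ {X Y Z : D} (f : X ⟶ Y) (g : Y ⟶ Z), dagger (f ≫ g) = dagger g ≫ dagger f

/-- A dagger monoidal category: the dagger preserves tensor products and the coherence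
isomorphisms are unitary. -/
class DaggerMonoidalCategory (D : Type u) [Category.{v} D] [MonoidalCategory D] extends
    DaggerCategory D where
  dagger_tensorHom : ∀ {X₁ Y₁ X₂ Y₂ : D} (f : X₁ ⟶ Y₁) (g : X₂ ⟶ Y₂),
    dagger (f ⊗ₘ g) = dagger f ⊗ₘ dagger g
  dagger_associator_hom : ∀ X Y Z : D, dagger (α_ X Y Z).hom = (α_ X Y Z).inv
  dagger_leftUnitor_hom : ∀ X : D, dagger (λ_ X).hom = (λ_ X).inv
  dagger_rightUnitor_hom : ∀ X : D, dagger (ρ_ X).hom = (ρ_ X).inv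

/-- Unitality: `μ ∘ (η ⊗ 1) = 1 = μ ∘ (1 ⊗ η)`. -/
structure IsUnital {D : Type u} [Category.{v} D] [MonoidalCategory D] {A : D}
    (μ : A ⊗ A ⟶ A) (η : 𝟙_ D ⟶ A) : Prop where
  unit_mul : (λ_ A).inv ≫ (η ▷ A) ≫ μ = 𝟙 A
  mul_unit : (ρ_ A).inv ≫ (A ◁ η) ≫ μ = 𝟙 A

/-- Special dagger Frobenius structures `(A, μ, η)` in a dagger monoidal category. -/
structure IsSpecialDaggerFrobenius {D : Type u} [Category.{v} D] [MonoidalCategory D]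
    [DaggerMonoidalCategory D] {A : D} (μ : A ⊗ A ⟶ A) (η : 𝟙_ D ⟶ A) : Prop extends
    IsUnital μ η where
  /-- associativity: `μ ∘ (μ ⊗ 1) = μ ∘ (1 ⊗ μ)` -/
  mul_assoc : (μ ▷ A) ≫ μ = (α_ A A A).hom ≫ (A ◁ μ) ≫ μ
  /-- speciality: `μ ∘ μ† = 1` -/
  special : DaggerCategory.dagger μ ≫ μ = 𝟙 A
  /-- the Frobenius law: `(μ ⊗ 1) ∘ (1 ⊗ μ†) = (1 ⊗ μ) ∘ (μ† ⊗ 1)` -/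
  frobenius : (A ◁ DaggerCategory.dagger μ) ≫ (α_ A A A).inv ≫ (μ ▷ A) =
    (DaggerCategory.dagger μ ▷ A) ≫ (α_ A A A).hom ≫ (A ◁ μ)

/-! ### Internal categories and groupoids -/

/-- An internal category with object of objects `C₀` and object of morphisms `C₁`. The composite
`m (a, b)` is defined when `s a = t b`. -/
structure InternalCategory {C : Type u} [Category.{v} C] [HasPullbacks C] (C₀ C₁ : C) where
  /-- source -/
  s : C₁ ⟶ C₀
  /-- target -/
  t : C₁ ⟶ C₀
  /-- identities -/
  u : C₀ ⟶ C₁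
  /-- composition -/
  m : pullback s t ⟶ C₁
  u_s : u ≫ s = 𝟙 C₀
  u_t : u ≫ t = 𝟙 C₀
  m_s : m ≫ s = pullback.snd s t ≫ s
  m_t : m ≫ t = pullback.fst s t ≫ t
  /-- `m (a, u (s a)) = a` -/
  comp_id : pullback.lift (𝟙 C₁) (s ≫ u) (by rw [Category.assoc, u_t]; simp) ≫ m = 𝟙 C₁
  /-- `m (u (t a), a) = a` -/
  id_comp : pullback.lift (t ≫ u) (𝟙 C₁) (by rw [Category.assoc, u_s]; simp) ≫ m = 𝟙 C₁
  /-- `m (m (a, b), c) = m (a, m (b, c))` on generalized elements -/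
  assoc : ∀ {T : C} (a b c : T ⟶ C₁) (hab : a ≫ s = b ≫ t) (hbc : b ≫ s = c ≫ t),
    pullback.lift (pullback.lift a b hab ≫ m) c
        (by rw [Category.assoc, m_s, pullback.lift_snd_assoc, hbc]) ≫ m =
      pullback.lift a (pullback.lift b c hbc ≫ m)
        (by rw [Category.assoc, m_t, pullback.lift_fst_assoc, hab]) ≫ m

/-- An internal groupoid: an internal category with an inversion morphism. -/
structure InternalGroupoid {C : Type u} [Category.{v} C] [HasPullbacks C] (C₀ C₁ : C) extends
    InternalCategory C₀ C₁ where
  /-- inversion -/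
  i : C₁ ⟶ C₁
  i_s : i ≫ s = t
  i_t : i ≫ t = s
  /-- `m (a, i a) = u (t a)` -/
  comp_inv : pullback.lift (𝟙 C₁) i (by rw [i_t]; simp) ≫ m = t ≫ u
  /-- `m (i a, a) = u (s a)` -/
  inv_comp : pullback.lift i (𝟙 C₁) (by rw [i_s]; simp) ≫ m = s ≫ u

/-! ### The dagger monoidal category of relations in a regular category -/

/-- The objects of the category of relations in `C`: the same as those of `C`. -/
structure RelCategory (C : Type u) where
  /-- the underlying object of `C` -/
  obj : C

namespace RelCategory

section Basic

variable {C : Type u} [Category.{v} C] [CartesianMonoidalCategory C]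

/-- A morphism `A ⟶ B` in the category of relations is a subobject of `A × B`. -/
@[ext]
structure Hom (A B : RelCategory C) where
  /-- the underlying subobject -/
  sub : Subobject (A.obj ⊗ B.obj)

/-- `R.Holds a b` says that the generalized elements `a` and `b` are related by `R`. -/
def Hom.Holds {A B : RelCategory C} (R : Hom A B) {T : C} (a : T ⟶ A.obj) (b : T ⟶ B.obj) : Prop :=
  R.sub.Factors (lift a b)

lemma Hom.holds_comp {A B : RelCategory C} {R : Hom A B} {T T' : C} (e : T' ⟶ T)
    {a : T ⟶ A.obj} {b : T ⟶ B.obj} (h : R.Holds a b) : R.Holds (e ≫ a) (e ≫ b) := by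
  have := Subobject.factors_of_factors_right e h
  rwa [comp_lift] at this

lemma Hom.holds_arrow {A B : RelCategory C} (R : Hom A B) :
    R.Holds (R.sub.arrow ≫ fst _ _) (R.sub.arrow ≫ snd _ _) := by
  have : lift (R.sub.arrow ≫ fst A.obj B.obj) (R.sub.arrow ≫ snd _ _) = R.sub.arrow := by
    ext <;> simp
  rw [Hom.Holds, this]
  exact Subobject.factors_self _

lemma Hom.ext_holds {A B : RelCategory C} {R S : Hom A B}
    (h : ∀ (T : C) (a : T ⟶ A.obj) (b : T ⟶ B.obj), R.Holds a b ↔ S.Holds a b) : R = S := by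
  have key : ∀ R S : Hom A B, (∀ (T : C) (a : T ⟶ A.obj) (b : T ⟶ B.obj),
      R.Holds a b → S.Holds a b) → R.sub ≤ S.sub := by
    intro R S h
    apply Subobject.le_of_factors
    have h1 := h _ _ _ R.holds_arrow
    rw [Hom.Holds] at h1
    convert h1 using 1
    ext <;> simp
  exact Hom.ext (le_antisymm (key R S fun T a b => (h T a b).1) (key S R fun T a b => (h T a b).2))

/-- The relation given by a jointly monic span `A ⟵ R ⟶ B`. -/
noncomputable def ofSpan {A B : RelCategory C} {R : C} (f : R ⟶ A.obj) (g : R ⟶ B.obj)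
    [Mono (lift f g)] : Hom A B := ⟨Subobject.mk (lift f g)⟩

lemma ofSpan_holds {A B : RelCategory C} {R : C} (f : R ⟶ A.obj) (g : R ⟶ B.obj)
    [Mono (lift f g)] {T : C} (a : T ⟶ A.obj) (b : T ⟶ B.obj) :
    (ofSpan (A := A) (B := B) f g).Holds a b ↔ ∃ r : T ⟶ R, r ≫ f = a ∧ r ≫ g = b := by
  constructor
  · intro h
    obtain ⟨r, hr⟩ : ∃ r : T ⟶ R, r ≫ lift f g = lift a b := h
    rw [comp_lift] at hr
    refine ⟨r, ?_, ?_⟩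
    · simpa using congrArg (· ≫ fst _ _) hr
    · simpa using congrArg (· ≫ snd _ _) hr
  · rintro ⟨r, rfl, rfl⟩
    refine ⟨r, ?_⟩
    change r ≫ lift f g = _
    rw [comp_lift]

instance {A B : C} (f : A ⟶ B) : Mono (lift (𝟙 A) f) :=
  mono_of_mono_fac (h := 𝟙 A) (lift_fst (𝟙 A) f)

/-- The graph of a morphism of `C`. -/
noncomputable def graph {A B : C} (f : A ⟶ B) : Hom (mk A) (mk B) :=
  ofSpan (A := mk A) (B := mk B) (𝟙 A) f

@[simp] lemma graph_holds {A B : C} (f : A ⟶ B) {T : C} (a : T ⟶ A) (b : T ⟶ B) :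
    (graph f).Holds a b ↔ a ≫ f = b := by
  rw [graph, ofSpan_holds]
  constructor
  · rintro ⟨r, rfl, rfl⟩
    simp
  · rintro rfl
    exact ⟨a, by simp, rfl⟩

end Basic

section Regular

set_option linter.unusedSectionVars false

variable {C : Type u} [Category.{v} C] [CartesianMonoidalCategory C] [Regular C]

/-- The opposite relation: `R† (b, a) ↔ R (a, b)`. -/
noncomputable def Hom.dagger {A B : RelCategory C} (R : Hom A B) : Hom B A :=
  ⟨(Subobject.pullback (lift (snd B.obj A.obj) (fst B.obj A.obj))).obj R.sub⟩

/-- The composite of relations: the image in `A × C` of the pullback `R ×_B S`. -/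
noncomputable def Hom.comp {A B D : RelCategory C} (R : Hom A B) (S : Hom B D) : Hom A D :=
  ⟨imageSubobject (lift
    (pullback.fst (R.sub.arrow ≫ snd _ _) (S.sub.arrow ≫ fst _ _) ≫ R.sub.arrow ≫ fst _ _)
    (pullback.snd (R.sub.arrow ≫ snd _ _) (S.sub.arrow ≫ fst _ _) ≫ S.sub.arrow ≫ snd _ _))⟩

/-- The product of relations: `(R ⊗ S) ((a, b), (a', b')) ↔ R (a, a') ∧ S (b, b')`. -/
noncomputable def Hom.tensor {A B A' B' : RelCategory C} (R : Hom A A') (S : Hom B B') :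
    Hom (RelCategory.mk (A.obj ⊗ B.obj)) (RelCategory.mk (A'.obj ⊗ B'.obj)) :=
  ⟨(Subobject.pullback (fst A.obj B.obj ⊗ₘ fst A'.obj B'.obj)).obj R.sub ⊓
    (Subobject.pullback (snd A.obj B.obj ⊗ₘ snd A'.obj B'.obj)).obj S.sub⟩

@[simp] lemma dagger_holds {A B : RelCategory C} (R : Hom A B) {T : C} (b : T ⟶ B.obj)
    (a : T ⟶ A.obj) : R.dagger.Holds b a ↔ R.Holds a b := by
  simp only [Hom.Holds, Hom.dagger, pullback_factors_iff, comp_lift, lift_fst, lift_snd]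

@[simp] lemma tensor_holds {A B A' B' : RelCategory C} (R : Hom A A') (S : Hom B B') {T : C}
    (p : T ⟶ A.obj ⊗ B.obj) (q : T ⟶ A'.obj ⊗ B'.obj) :
    (R.tensor S).Holds p q ↔
      R.Holds (p ≫ fst _ _) (q ≫ fst _ _) ∧ S.Holds (p ≫ snd _ _) (q ≫ snd _ _) := by
  simp only [Hom.Holds, Hom.tensor, Subobject.inf_factors, pullback_factors_iff, lift_map]

lemma strongEpi_snd {X Y Z : C} (f : X ⟶ Z) (g : Y ⟶ Z) [StrongEpi f] :
    StrongEpi (pullback.snd f g) := by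
  have : IsRegularEpi f := inferInstance
  infer_instance

lemma image_factors {X Y T : C} (f : X ⟶ Y) (g : T ⟶ Y) :
    (imageSubobject f).Factors g ↔
      ∃ (T' : C) (e : T' ⟶ T) (_ : StrongEpi e) (h : T' ⟶ X), h ≫ f = e ≫ g := by
  constructor
  · intro hg
    have : StrongEpi (factorThruImageSubobject f) := by
      have : StrongEpi (factorThruImage f) :=
        strongEpi_of_strongEpiMonoFactorisation (Regular.strongEpiMonoFactorisation f)
          (Image.isImage f)
      unfold factorThruImageSubobject
      exact strongEpi_comp _ _
    refine ⟨_, pullback.snd (factorThruImageSubobject f) ((imageSubobject f).factorThru g hg),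
      strongEpi_snd _ _, pullback.fst _ _, ?_⟩
    have h1 := pullback.condition (f := factorThruImageSubobject f)
      (g := (imageSubobject f).factorThru g hg)
    have h2 := congrArg (· ≫ (imageSubobject f).arrow) h1
    simpa using h2
  · rintro ⟨T', e, he, h, w⟩
    have sq : CommSq (h ≫ factorThruImageSubobject f) e (imageSubobject f).arrow g :=
      ⟨by simpa using w⟩
    rw [← sq.fac_right]
    exact Subobject.factors_comp_arrow _

/-- Composition of relations in terms of generalized elements. -/
lemma comp_holds {A B D : RelCategory C} (R : Hom A B) (S : Hom B D) {T : C}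
    (a : T ⟶ A.obj) (d : T ⟶ D.obj) :
    (R.comp S).Holds a d ↔ ∃ (T' : C) (e : T' ⟶ T) (_ : StrongEpi e) (b : T' ⟶ B.obj),
      R.Holds (e ≫ a) b ∧ S.Holds b (e ≫ d) := by
  rw [Hom.Holds, Hom.comp, image_factors]
  constructor
  · rintro ⟨T', e, he, h, w⟩
    have w1 := congrArg (· ≫ fst _ _) w
    have w2 := congrArg (· ≫ snd _ _) w
    simp only [Category.assoc, lift_fst, lift_snd] at w1 w2
    refine ⟨T', e, he, (h ≫ pullback.fst _ _) ≫ R.sub.arrow ≫ snd _ _, ?_, ?_⟩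
    · rw [← w1]
      simpa using Hom.holds_comp (h ≫ pullback.fst _ _) R.holds_arrow
    · rw [← w2]
      have := Hom.holds_comp (h ≫ pullback.snd _ _) S.holds_arrow
      simpa [pullback.condition] using this
  · rintro ⟨T', e, he, b, hR, hS⟩
    obtain ⟨r, hr⟩ : ∃ r : T' ⟶ _, r ≫ R.sub.arrow = lift (e ≫ a) b :=
      ⟨_, Subobject.factorThru_arrow _ _ hR⟩
    obtain ⟨s, hs⟩ : ∃ s : T' ⟶ _, s ≫ S.sub.arrow = lift b (e ≫ d) :=
      ⟨_, Subobject.factorThru_arrow _ _ hS⟩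
    have w : r ≫ R.sub.arrow ≫ snd _ _ = s ≫ S.sub.arrow ≫ fst _ _ := by
      rw [reassoc_of% hr, reassoc_of% hs]; simp
    refine ⟨T', e, he, pullback.lift r s w, ?_⟩
    ext
    · rw [Category.assoc, lift_fst, pullback.lift_fst_assoc, reassoc_of% hr]
      simp
    · rw [Category.assoc, lift_snd, pullback.lift_snd_assoc, reassoc_of% hs]
      simp

/-- Relations satisfy descent along strong (equivalently, regular) epimorphisms. -/
lemma Hom.holds_of_cover {A B : RelCategory C} (R : Hom A B) {T T' : C} (e : T' ⟶ T) [StrongEpi e]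
    {a : T ⟶ A.obj} {b : T ⟶ B.obj} (h : R.Holds (e ≫ a) (e ≫ b)) : R.Holds a b := by
  rw [Hom.Holds, ← comp_lift] at h
  have sq : CommSq (R.sub.factorThru _ h) e R.sub.arrow (lift a b) := ⟨by simp⟩
  rw [Hom.Holds, ← sq.fac_right]
  exact Subobject.factors_comp_arrow _

lemma graph_comp_holds {A B : C} {D : RelCategory C} (f : A ⟶ B) (S : Hom (mk B) D) {T : C}
    (a : T ⟶ A) (d : T ⟶ D.obj) : ((graph f).comp S).Holds a d ↔ S.Holds (a ≫ f) d := by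
  rw [comp_holds]
  constructor
  · rintro ⟨T', e, he, b, h1, h2⟩
    rw [graph_holds] at h1
    subst h1
    rw [Category.assoc] at h2
    exact S.holds_of_cover e h2
  · intro h
    exact ⟨T, 𝟙 T, inferInstance, a ≫ f, by simp, by simpa using h⟩

lemma comp_graph_holds {A B : C} {D : RelCategory C} (S : Hom D (mk A)) (f : A ≅ B) {T : C}
    (d : T ⟶ D.obj) (b : T ⟶ B) : (S.comp (graph f.hom)).Holds d b ↔ S.Holds d (b ≫ f.inv) := by
  rw [comp_holds]
  constructor
  · rintro ⟨T', e, he, a, h1, h2⟩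
    rw [graph_holds] at h2
    rw [← Iso.eq_comp_inv] at h2
    subst h2
    rw [Category.assoc] at h1
    exact S.holds_of_cover e h1
  · intro h
    exact ⟨T, 𝟙 T, inferInstance, b ≫ f.inv, by simpa using h, by simp⟩

/-- The category of relations in the regular category `C`, with diagonals as identities. -/
noncomputable instance : Category (RelCategory C) where
  Hom A B := Hom A B
  id A := graph (𝟙 A.obj)
  comp R S := Hom.comp R S
  id_comp R := Hom.ext_holds fun T a b => by
    rw [graph_comp_holds]; simp
  comp_id {A B} R := Hom.ext_holds fun T a b => by
    have := comp_graph_holds R (Iso.refl B.obj) a b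
    simpa using this
  assoc R S Q := Hom.ext_holds fun T a d => by
    simp only [comp_holds]
    constructor
    · rintro ⟨T', e, he, c, ⟨T'', e', he', b, h1, h2⟩, h3⟩
      refine ⟨T'', e' ≫ e, strongEpi_comp _ _, b, by simpa using h1, T'', 𝟙 _, inferInstance,
        e' ≫ c, by simpa using h2, ?_⟩
      simpa using Hom.holds_comp e' h3
    · rintro ⟨T', e, he, b, h1, T'', e', he', c, h2, h3⟩
      refine ⟨T'', e' ≫ e, strongEpi_comp _ _, c, ⟨T'', 𝟙 _, inferInstance, e' ≫ b, ?_, ?_⟩, ?_⟩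
      · simpa using Hom.holds_comp e' h1
      · simpa using h2
      · simpa using h3

lemma graph_comp_graph {A B D : C} (f : A ⟶ B) (g : B ⟶ D) :
    (graph f).comp (graph g) = graph (f ≫ g) :=
  Hom.ext_holds fun T a d => by
    have h1 := graph_comp_holds f (graph g) a d
    have h2 := graph_holds g (a ≫ f) d
    have h3 := graph_holds (f ≫ g) a d
    rw [Category.assoc] at h2
    exact h1.trans (h2.trans h3.symm)

lemma graph_tensor_graph {A B A' B' : C} (f : A ⟶ A') (g : B ⟶ B') :
    (graph f).tensor (graph g) = graph (f ⊗ₘ g) :=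
  Hom.ext_holds fun T p q => by
    refine (tensor_holds _ _ p q).trans ?_
    rw [graph_holds, graph_holds, graph_holds]
    constructor
    · rintro ⟨h1, h2⟩
      ext
      · simpa using h1
      · simpa using h2
    · rintro rfl
      simp

/-- The graph of an isomorphism is an isomorphism in the category of relations. -/
@[simps]
noncomputable def graphIso {A B : C} (f : A ≅ B) : RelCategory.mk A ≅ RelCategory.mk B where
  hom := graph f.hom
  inv := graph f.inv
  hom_inv_id := (graph_comp_graph _ _).trans (by rw [f.hom_inv_id]; rfl)
  inv_hom_id := (graph_comp_graph _ _).trans (by rw [f.inv_hom_id]; rfl)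

lemma tensor_comp_tensor {A A' A'' B B' B'' : RelCategory C} (R : Hom A A') (S : Hom B B')
    (R' : Hom A' A'') (S' : Hom B' B'') :
    (R.tensor S).comp (R'.tensor S') = (R.comp R').tensor (S.comp S') :=
  Hom.ext_holds fun T p q => by
    refine (comp_holds _ _ p q).trans (Iff.trans ?_ (tensor_holds _ _ p q).symm)
    simp only [comp_holds]
    constructor
    · rintro ⟨T', e, he, m, h1, h2⟩
      have h1' := (tensor_holds _ _ _ _).1 h1
      have h2' := (tensor_holds _ _ _ _).1 h2
      simp only [Category.assoc] at h1' h2'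
      exact ⟨⟨T', e, he, m ≫ fst _ _, h1'.1, h2'.1⟩, ⟨T', e, he, m ≫ snd _ _, h1'.2, h2'.2⟩⟩
    · rintro ⟨⟨T₁, e₁, he₁, b₁, h1, h2⟩, ⟨T₂, e₂, he₂, b₂, h3, h4⟩⟩
      have := strongEpi_snd e₁ e₂
      refine ⟨pullback e₁ e₂, pullback.snd e₁ e₂ ≫ e₂, strongEpi_comp _ _,
        lift (pullback.fst e₁ e₂ ≫ b₁) (pullback.snd e₁ e₂ ≫ b₂), ?_, ?_⟩
      · refine (tensor_holds _ _ _ _).2 ⟨?_, ?_⟩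
        · have := Hom.holds_comp (pullback.fst e₁ e₂) h1
          simpa [pullback.condition_assoc] using this
        · have := Hom.holds_comp (pullback.snd e₁ e₂) h3
          simpa using this
      · refine (tensor_holds _ _ _ _).2 ⟨?_, ?_⟩
        · have := Hom.holds_comp (pullback.fst e₁ e₂) h2
          simpa [pullback.condition_assoc] using this
        · have := Hom.holds_comp (pullback.snd e₁ e₂) h4
          simpa using this

lemma dagger_graph_hom {A B : C} (f : A ≅ B) : (graph f.hom).dagger = graph f.inv :=
  Hom.ext_holds fun T b a => by
    refine (dagger_holds _ _ _).trans ((graph_holds _ _ _).trans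
      (Iff.trans ?_ (graph_holds _ _ _).symm))
    exact (Iso.eq_comp_inv f).symm.trans eq_comm

noncomputable instance : MonoidalCategoryStruct (RelCategory C) where
  tensorObj A B := mk (A.obj ⊗ B.obj)
  tensorUnit := mk (𝟙_ C)
  whiskerLeft A _ _ R := Hom.tensor (graph (𝟙 A.obj)) R
  whiskerRight R B := Hom.tensor R (graph (𝟙 B.obj))
  tensorHom R S := Hom.tensor R S
  associator A B D := graphIso (α_ A.obj B.obj D.obj)
  leftUnitor A := graphIso (λ_ A.obj)
  rightUnitor A := graphIso (ρ_ A.obj)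

/-- The tensor product on the category of relations, induced by the products of `C`. -/
noncomputable instance : MonoidalCategory (RelCategory C) :=
  MonoidalCategory.ofTensorHom
    (id_tensorHom_id := fun A B => (graph_tensor_graph _ _).trans (by
      rw [id_tensorHom_id]; rfl))
    (id_tensorHom := fun _ _ _ _ => rfl)
    (tensorHom_id := fun _ _ => rfl)
    (tensorHom_comp_tensorHom := fun R S R' S' => tensor_comp_tensor R S R' S')
    (associator_naturality := fun {X₁ X₂ X₃ Y₁ Y₂ Y₃} R S Q => Hom.ext_holds fun T p q => by
      refine (comp_graph_holds (Hom.tensor (Hom.tensor R S) Q)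
        (α_ Y₁.obj Y₂.obj Y₃.obj) p q).trans
        (Iff.trans ?_ (graph_comp_holds (α_ X₁.obj X₂.obj X₃.obj).hom _ p q).symm)
      refine (tensor_holds _ _ _ _).trans (Iff.trans (and_congr_left' (tensor_holds _ _ _ _)) ?_)
      refine Iff.trans ?_ ((tensor_holds _ _ _ _).trans
        (and_congr_right' (tensor_holds _ _ _ _))).symm
      simp [and_assoc])
    (leftUnitor_naturality := fun {X Y} R =>
      Hom.ext_holds fun T (p : T ⟶ 𝟙_ C ⊗ X.obj) (q : T ⟶ Y.obj) => by
      refine (comp_graph_holds (Hom.tensor (graph (𝟙 (𝟙_ C))) R) (λ_ Y.obj) p q).trans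
        (Iff.trans ?_ (graph_comp_holds (λ_ X.obj).hom _ p q).symm)
      refine (tensor_holds _ _ _ _).trans ?_
      rw [graph_holds]
      have h0 : (p ≫ fst _ _) ≫ 𝟙 (𝟙_ C) = (q ≫ (λ_ Y.obj).inv) ≫ fst _ _ := toUnit_unique _ _
      simp only [h0, true_and, Category.assoc, leftUnitor_hom, leftUnitor_inv_snd,
        Category.comp_id])
    (rightUnitor_naturality := fun {X Y} R =>
      Hom.ext_holds fun T (p : T ⟶ X.obj ⊗ 𝟙_ C) (q : T ⟶ Y.obj) => by
      refine (comp_graph_holds (Hom.tensor R (graph (𝟙 (𝟙_ C)))) (ρ_ Y.obj) p q).trans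
        (Iff.trans ?_ (graph_comp_holds (ρ_ X.obj).hom _ p q).symm)
      refine (tensor_holds _ _ _ _).trans ?_
      rw [graph_holds]
      have h0 : (p ≫ snd _ _) ≫ 𝟙 (𝟙_ C) = (q ≫ (ρ_ Y.obj).inv) ≫ snd _ _ := toUnit_unique _ _
      simp only [h0, and_true, Category.assoc, rightUnitor_hom, rightUnitor_inv_fst,
        Category.comp_id])
    (pentagon := fun W X Y Z => by
      have h := congrArg graph (pentagon W.obj X.obj Y.obj Z.obj)
      change ((graph _).tensor (graph _)).comp ((graph _).comp ((graph _).tensor (graph _))) =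
        (graph _).comp (graph _)
      simp only [graph_tensor_graph, graph_comp_graph]
      simp only [tensorHom_id, id_tensorHom]
      exact h)
    (triangle := fun X Y => by
      have h := congrArg graph (triangle X.obj Y.obj)
      change (graph _).comp ((graph _).tensor (graph _)) = (graph _).tensor (graph _)
      simp only [graph_tensor_graph, graph_comp_graph]
      simp only [tensorHom_id, id_tensorHom]
      exact h)

/-- The category of relations is a dagger monoidal category, `R†` being the opposite relation. -/
noncomputable instance : DaggerMonoidalCategory (RelCategory C) where
  dagger R := Hom.dagger R
  dagger_dagger R := Hom.ext_holds fun T a b => by simp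
  dagger_id A := Hom.ext_holds fun T a b => by
    refine (dagger_holds (graph (𝟙 A.obj)) a b).trans ?_
    refine (graph_holds _ _ _).trans (Iff.trans ?_ (graph_holds _ _ _).symm)
    rw [Category.comp_id, Category.comp_id, eq_comm]
  dagger_comp R S := Hom.ext_holds fun T a d => by
    refine (dagger_holds (Hom.comp R S) a d).trans
      ((comp_holds _ _ _ _).trans (Iff.trans ?_ (comp_holds _ _ _ _).symm))
    simp only [dagger_holds, and_comm]
  dagger_tensorHom R S := Hom.ext_holds fun T p q => by
    refine (dagger_holds (Hom.tensor R S) p q).trans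
      ((tensor_holds _ _ _ _).trans (Iff.trans ?_ (tensor_holds _ _ _ _).symm))
    simp only [dagger_holds]
  dagger_associator_hom X Y Z := dagger_graph_hom (α_ X.obj Y.obj Z.obj)
  dagger_leftUnitor_hom X := dagger_graph_hom (λ_ X.obj)
  dagger_rightUnitor_hom X := dagger_graph_hom (ρ_ X.obj)

end Regular

end RelCategory

/-! ### Composition and identities of an internal category, as relations -/

namespace InternalCategory

variable {C : Type u} [Category.{v} C] [CartesianMonoidalCategory C] [Regular C] {C₀ C₁ : C}

instance mono_lift_u (G : InternalCategory C₀ C₁) : Mono (lift (toUnit C₀) G.u) :=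
  ⟨fun a b h => by
    have h' := congrArg (· ≫ snd _ _ ≫ G.s) h
    simpa [G.u_s] using h'⟩

instance mono_lift_m (G : InternalCategory C₀ C₁) :
    Mono (lift (lift (pullback.fst G.s G.t) (pullback.snd G.s G.t)) G.m) :=
  ⟨fun a b h => by
    have h₁ := congrArg (· ≫ fst _ _ ≫ fst _ _) h
    have h₂ := congrArg (· ≫ fst _ _ ≫ snd _ _) h
    apply pullback.hom_ext
    · simpa using h₁
    · simpa using h₂⟩

/-- The identities `u : C₀ ↣ C₁`, regarded as a relation from the terminal object to `C₁`. -/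
noncomputable def idRel (G : InternalCategory C₀ C₁) :
    𝟙_ (RelCategory C) ⟶ RelCategory.mk C₁ :=
  RelCategory.ofSpan (A := RelCategory.mk (𝟙_ C)) (B := RelCategory.mk C₁) (toUnit C₀) G.u

/-- The composition of an internal category, regarded as the relation from `C₁ × C₁` to `C₁`
given by the span `C₁ × C₁ ↢ C₁ ×_{C₀} C₁ ⟶ C₁`. -/
noncomputable def compRel (G : InternalCategory C₀ C₁) :
    RelCategory.mk C₁ ⊗ RelCategory.mk C₁ ⟶ RelCategory.mk C₁ :=
  RelCategory.ofSpan (A := RelCategory.mk (C₁ ⊗ C₁)) (B := RelCategory.mk C₁)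
    (lift (pullback.fst G.s G.t) (pullback.snd G.s G.t)) G.m

end InternalCategory

/-! ### Difunctionality in Mal'cev categories -/

section Malcev

variable {C : Type u} [Category.{v} C] [CartesianMonoidalCategory C]

/-! Calculate in relations with generalized elements: `μ` is a ternary relation "a b = c", `η` a
subobject of identities, and a witness in a composite relation exists only after pulling back along
a strong epimorphism, a cover. The Mal'cev condition enters as difunctionality: if (x, y), (x', y)
and (x', y') are related, so are (x, y').

Applied to `μ` with one variable split off from the other two, difunctionality and the unit laws
show that any two of a, b, c determine the third (`mul_unique`, `mul_left_cancel`,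
`mul_right_cancel`). Uniqueness turns local existence into global existence
(`exists_factors_of_cover`), so every element has a genuine source and target identity.

Applied to the images of `μ` under projections, such as "a b is defined" or "c is a left multiple of
b", difunctionality through well-chosen identities yields the rest: a b is defined exactly when the
source of a is the target of b (`exists_mul_iff`), one-sided inverses exist, and products have the
expected source and target. Applied to "both bracketings of a, b, c exist and agree", as a relation
between a and (b, c), it yields associativity (`exists_assoc`) from triples containing identities.
Evaluating at generic elements produces an internal groupoid.

Conversely, the unit laws hold for any internal category, and the Frobenius law for a groupoid
amounts to replacing a connecting arrow by its inverse. -/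

/-- In a Mal'cev category with finite limits every relation is difunctional. -/
lemma IsMalcev.difunctional [HasFiniteLimits C] (hC : IsMalcev C) {X Y W : C} (S : Subobject W)
    (φ : X ⊗ Y ⟶ W) {T : C} {x x' : T ⟶ X} {y y' : T ⟶ Y} (h₁ : S.Factors (lift x y ≫ φ))
    (h₂ : S.Factors (lift x' y ≫ φ)) (h₃ : S.Factors (lift x' y' ≫ φ)) :
    S.Factors (lift x y' ≫ φ) := by
  let V : Subobject (X ⊗ Y) := (Subobject.pullback φ).obj S
  have hV : ∀ {T : C} (x : T ⟶ X) (y : T ⟶ Y), V.Factors (lift x y) ↔ S.Factors (lift x y ≫ φ) :=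
    fun x y => pullback_factors_iff ..
  rw [← hV] at h₁ h₂ h₃ ⊢
  let R : C := (V : C)
  -- Relate v to w in `V` when the first coordinate of v and the second coordinate of w form a pair
  -- in `V`. This is reflexive because v itself lies in `V`.
  let ψ : R ⊗ R ⟶ X ⊗ Y := lift (fst R R ≫ V.arrow ≫ fst X Y) (snd R R ≫ V.arrow ≫ snd X Y)
  let P : Subobject (R ⊗ R) := (Subobject.pullback ψ).obj V
  have hP : ∀ {T : C} (a b : T ⟶ R), P.Factors (lift a b) ↔
      V.Factors (lift (a ≫ V.arrow ≫ fst X Y) (b ≫ V.arrow ≫ snd X Y)) := by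
    intro T a b
    refine (pullback_factors_iff ..).trans ?_
    simp only [ψ, comp_lift, lift_fst_assoc, lift_snd_assoc]
  have hrefl : P.Factors (lift (𝟙 R) (𝟙 R)) := by
    rw [hP]
    have : lift (𝟙 R ≫ V.arrow ≫ fst X Y) (𝟙 R ≫ V.arrow ≫ snd X Y) = V.arrow := by
      ext <;> simp
    rw [this]
    exact Subobject.factors_self _
  have e : ReflexiveRelation (P.arrow ≫ fst R R) (P.arrow ≫ snd R R) :=
    { right_cancellation := fun Z f g h h' => by
        rw [← cancel_mono P.arrow]
        refine CartesianMonoidalCategory.hom_ext _ _ ?_ ?_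
        · simpa using h
        · simpa using h'
      r := P.factorThru _ hrefl
      reflexivity₁ := by simp
      reflexivity₂ := by simp }
  obtain ⟨⟨E⟩⟩ := hC _ _ ⟨e⟩
  -- For p = (x, y), q = (x', y), r = (x', y'), p is related to q by `h₁` and q to r by `h₃`;
  -- transitivity relates p to r, which says that (x, y') lies in `V`. The role of `h₂` is to supply
  -- the middle point q.
  let p := V.factorThru _ h₁
  let q := V.factorThru _ h₂
  let r := V.factorThru _ h₃
  have hpq : P.Factors (lift p q) := by
    rw [hP]
    simpa [p, q] using h₁
  have hqr : P.Factors (lift q r) := by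
    rw [hP]
    simpa [q, r] using h₃
  obtain ⟨l, hl₁, hl₂⟩ := PullbackCone.IsLimit.lift' E.isLimit (P.factorThru _ hpq)
    (P.factorThru _ hqr) (by simp)
  have key : l ≫ E.t ≫ P.arrow = lift p r := by
    have t₁ := E.transitivity₁
    have t₂ := E.transitivity₂
    refine CartesianMonoidalCategory.hom_ext _ _ ?_ ?_
    · simp only [Category.assoc, t₁, reassoc_of% hl₁, Subobject.factorThru_arrow_assoc]
      rw [lift_fst, lift_fst]
    · simp only [Category.assoc, t₂, reassoc_of% hl₂, Subobject.factorThru_arrow_assoc]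
      rw [lift_snd, lift_snd]
  have hpr : P.Factors (lift p r) := by
    rw [← key, ← Category.assoc]
    exact Subobject.factors_comp_arrow _
  rw [hP] at hpr
  simpa [p, r] using hpr

end Malcev

/-! ### Unique choice, and `μ`, `η` on generalized elements -/

namespace RelCategory

section

variable {C : Type u} [Category.{v} C] [CartesianMonoidalCategory C]

lemma exists_eq_lift {T X Y : C} (p : T ⟶ X ⊗ Y) : ∃ (x : T ⟶ X) (y : T ⟶ Y), p = lift x y :=
  ⟨p ≫ fst X Y, p ≫ snd X Y, by rw [← comp_lift, lift_fst_snd, Category.comp_id]⟩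

/-- The permutation `((a, c), b) ↦ ((a, b), c)`. -/
noncomputable def permMiddle (A : C) : (A ⊗ A) ⊗ A ⟶ (A ⊗ A) ⊗ A :=
  lift (lift (fst _ _ ≫ fst _ _) (snd _ _)) (fst _ _ ≫ snd _ _)

/-- The permutation `((b, c), a) ↦ ((a, b), c)`. -/
noncomputable def permLeft (A : C) : (A ⊗ A) ⊗ A ⟶ (A ⊗ A) ⊗ A :=
  lift (lift (snd _ _) (fst _ _ ≫ fst _ _)) (fst _ _ ≫ snd _ _)

@[simp] lemma lift_permMiddle {T A : C} (a b c : T ⟶ A) :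
    lift (lift a c) b ≫ permMiddle A = lift (lift a b) c := by
  simp [permMiddle, comp_lift]

@[simp] lemma lift_permLeft {T A : C} (a b c : T ⟶ A) :
    lift (lift b c) a ≫ permLeft A = lift (lift a b) c := by
  simp [permLeft, comp_lift]

end

section

variable {C : Type u} [Category.{v} C] [CartesianMonoidalCategory C] [Regular C]

/-- Unique choice: a relation which is single-valued above `x` and is locally defined at `x`
has a value at `x`. -/
lemma exists_factors_of_cover {X Y W : C} (S : Subobject W) (φ : X ⊗ Y ⟶ W) {T : C} (x : T ⟶ X)
    (huniq : ∀ {T' : C} (e : T' ⟶ T) (y y' : T' ⟶ Y), S.Factors (lift (e ≫ x) y ≫ φ) →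
      S.Factors (lift (e ≫ x) y' ≫ φ) → y = y')
    {T' : C} (e : T' ⟶ T) [StrongEpi e] {y : T' ⟶ Y} (h : S.Factors (lift (e ≫ x) y ≫ φ)) :
    ∃ y : T ⟶ Y, S.Factors (lift x y ≫ φ) := by
  let V : Subobject (T ⊗ Y) := (Subobject.pullback (x ▷ Y ≫ φ)).obj S
  have hV : ∀ {T' : C} (z : T' ⟶ T) (y : T' ⟶ Y), V.Factors (lift z y) ↔
      S.Factors (lift (z ≫ x) y ≫ φ) := by
    intro T' z y
    refine (pullback_factors_iff ..).trans ?_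
    rw [← Category.assoc, lift_whiskerRight]
  have hVa : lift (V.arrow ≫ fst _ _) (V.arrow ≫ snd _ _) = V.arrow := by ext <;> simp
  have hself : ∀ {Z : C} (f : Z ⟶ (V : C)),
      S.Factors (lift ((f ≫ V.arrow ≫ fst _ _) ≫ x) (f ≫ V.arrow ≫ snd _ _) ≫ φ) := by
    intro Z f
    rw [← hV, ← comp_lift, hVa]
    exact Subobject.factors_comp_arrow _
  -- The projection from `V` to `T` is monic by single-valuedness and a strong epimorphism by the
  -- local value over `e`. It is therefore invertible, and `V` is the graph of the required
  -- morphism.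
  have hmono : Mono (V.arrow ≫ fst T Y) := ⟨fun f g hfg => by
    rw [← cancel_mono V.arrow]
    ext
    · simpa using hfg
    · have h₂ := hself g
      rw [← hfg] at h₂
      simpa using huniq _ _ _ (hself f) h₂⟩
  have hepi : StrongEpi (V.arrow ≫ fst T Y) := by
    have he : V.factorThru _ ((hV e y).2 h) ≫ V.arrow ≫ fst _ _ = e := by simp
    have : StrongEpi (V.factorThru _ ((hV e y).2 h) ≫ V.arrow ≫ fst _ _) := by rwa [he]
    exact strongEpi_of_strongEpi (V.factorThru _ ((hV e y).2 h)) _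
  have hiso : IsIso (V.arrow ≫ fst T Y) := isIso_of_mono_of_strongEpi _
  refine ⟨inv (V.arrow ≫ fst T Y) ≫ V.arrow ≫ snd _ _, ?_⟩
  simpa using hself (inv (V.arrow ≫ fst T Y))

variable {A : C}

/-- `Mul μ a b c`: the relation `μ` allows `c` as a product of the generalized elements `a, b`. -/
def Mul (μ : mk A ⊗ mk A ⟶ mk A) {T : C} (a b c : T ⟶ A) : Prop :=
  Hom.Holds (A := mk (A ⊗ A)) (B := mk A) μ (lift a b) c

/-- `IsId η u`: the generalized element `u` belongs to `η`, seen as a subobject of `A`. -/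
def IsId (η : 𝟙_ (RelCategory C) ⟶ mk A) {T : C} (u : T ⟶ A) : Prop :=
  Hom.Holds (A := mk (𝟙_ C)) (B := mk A) η (toUnit T) u

section

variable {μ : mk A ⊗ mk A ⟶ mk A} {η : 𝟙_ (RelCategory C) ⟶ mk A} {T T' : C}

lemma Mul.comp {a b c : T ⟶ A} (h : Mul μ a b c) (e : T' ⟶ T) :
    Mul μ (e ≫ a) (e ≫ b) (e ≫ c) := by
  have := Hom.holds_comp e h
  rwa [comp_lift] at this

lemma Mul.of_cover (e : T' ⟶ T) [StrongEpi e] {a b c : T ⟶ A}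
    (h : Mul μ (e ≫ a) (e ≫ b) (e ≫ c)) : Mul μ a b c := by
  rw [Mul, ← comp_lift] at h
  exact Hom.holds_of_cover (A := mk (A ⊗ A)) (B := mk A) μ e h

lemma IsId.comp {u : T ⟶ A} (h : IsId η u) (e : T' ⟶ T) : IsId η (e ≫ u) := by
  have := Hom.holds_comp e h
  rwa [comp_toUnit] at this

lemma IsId.of_cover (e : T' ⟶ T) [StrongEpi e] {u : T ⟶ A} (h : IsId η (e ≫ u)) : IsId η u := by
  rw [IsId, ← comp_toUnit e] at h
  exact Hom.holds_of_cover (A := mk (𝟙_ C)) (B := mk A) η e h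

lemma Mul.ext {μ' : mk A ⊗ mk A ⟶ mk A}
    (h : ∀ (T : C) (a b c : T ⟶ A), Mul μ a b c ↔ Mul μ' a b c) : μ = μ' :=
  Hom.ext_holds (A := mk (A ⊗ A)) (B := mk A) fun T p c => by
    have := h T (p ≫ fst _ _) (p ≫ snd _ _) c
    have hp : lift (p ≫ fst A A) (p ≫ snd A A) = p := by ext <;> simp
    rwa [Mul, Mul, hp] at this

lemma IsId.ext {η' : 𝟙_ (RelCategory C) ⟶ mk A}
    (h : ∀ (T : C) (u : T ⟶ A), IsId η u ↔ IsId η' u) : η = η' :=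
  Hom.ext_holds (A := mk (𝟙_ C)) (B := mk A) fun T p u => by
    obtain rfl : p = toUnit T := toUnit_unique _ _
    exact h T u

end

end

end RelCategory

/-! ### The unit, associativity, speciality and Frobenius laws on generalized elements -/

namespace RelCategory

variable {C : Type u} [Category.{v} C] [CartesianMonoidalCategory C] [Regular C]

/-- The identity strand forces the second coordinate of the intermediate pair, so only its first
coordinate remains quantified. -/
lemma whiskerRight_comp_holds {X Y A : C} {Z : RelCategory C} (R : mk X ⟶ mk Y)
    (S : mk Y ⊗ mk A ⟶ Z) {T : C} (x : T ⟶ X) (a : T ⟶ A) (d : T ⟶ Z.obj) :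
    Hom.Holds (A := mk (X ⊗ A)) ((R ▷ mk A) ≫ S) (lift x a) d ↔
      ∃ (T' : C) (e : T' ⟶ T) (_ : StrongEpi e) (y : T' ⟶ Y),
        Hom.Holds (A := mk X) (B := mk Y) R (e ≫ x) y ∧
          Hom.Holds (A := mk (Y ⊗ A)) S (lift y (e ≫ a)) (e ≫ d) := by
  refine (comp_holds (Hom.tensor R (graph (𝟙 A))) S (lift x a) d).trans ?_
  refine exists_congr fun T' => exists_congr fun e => exists_congr fun he => ?_
  have key : ∀ (y : T' ⟶ Y) (w : T' ⟶ A),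
      (Hom.tensor R (graph (𝟙 A))).Holds (e ≫ lift x a) (lift y w) ↔
        Hom.Holds (A := mk X) (B := mk Y) R (e ≫ x) y ∧ w = e ≫ a := by
    intro y w
    refine (tensor_holds _ _ _ _).trans ?_
    rw [graph_holds]
    simp only [comp_lift, lift_fst, lift_snd, Category.comp_id, eq_comm]
  constructor
  · rintro ⟨p, h, h'⟩
    obtain ⟨y, w, rfl⟩ := exists_eq_lift (X := Y) (Y := A) p
    obtain ⟨h₁, rfl⟩ := (key y w).1 h
    exact ⟨y, h₁, h'⟩
  · rintro ⟨y, h₁, h₂⟩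
    exact ⟨lift y (e ≫ a), (key _ _).2 ⟨h₁, rfl⟩, h₂⟩

lemma whiskerLeft_comp_holds {X Y A : C} {Z : RelCategory C} (R : mk X ⟶ mk Y)
    (S : mk A ⊗ mk Y ⟶ Z) {T : C} (a : T ⟶ A) (x : T ⟶ X) (d : T ⟶ Z.obj) :
    Hom.Holds (A := mk (A ⊗ X)) ((mk A ◁ R) ≫ S) (lift a x) d ↔
      ∃ (T' : C) (e : T' ⟶ T) (_ : StrongEpi e) (y : T' ⟶ Y),
        Hom.Holds (A := mk X) (B := mk Y) R (e ≫ x) y ∧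
          Hom.Holds (A := mk (A ⊗ Y)) S (lift (e ≫ a) y) (e ≫ d) := by
  refine (comp_holds (Hom.tensor (graph (𝟙 A)) R) S (lift a x) d).trans ?_
  refine exists_congr fun T' => exists_congr fun e => exists_congr fun he => ?_
  have key : ∀ (w : T' ⟶ A) (y : T' ⟶ Y),
      (Hom.tensor (graph (𝟙 A)) R).Holds (e ≫ lift a x) (lift w y) ↔
        w = e ≫ a ∧ Hom.Holds (A := mk X) (B := mk Y) R (e ≫ x) y := by
    intro w y
    refine (tensor_holds _ _ _ _).trans ?_
    rw [graph_holds]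
    simp only [comp_lift, lift_fst, lift_snd, Category.comp_id, eq_comm]
  constructor
  · rintro ⟨p, h, h'⟩
    obtain ⟨w, y, rfl⟩ := exists_eq_lift (X := A) (Y := Y) p
    obtain ⟨rfl, h₁⟩ := (key w y).1 h
    exact ⟨y, h₁, h'⟩
  · rintro ⟨y, h₁, h₂⟩
    exact ⟨lift (e ≫ a) y, (key _ _).2 ⟨rfl, h₁⟩, h₂⟩

variable {A : C} {μ : mk A ⊗ mk A ⟶ mk A} {η : 𝟙_ (RelCategory C) ⟶ mk A}

lemma hom_ext_iff {X Y : C} {R S : mk X ⟶ mk Y} :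
    R = S ↔ ∀ (T : C) (a : T ⟶ X) (b : T ⟶ Y),
      Hom.Holds (A := mk X) (B := mk Y) R a b ↔ Hom.Holds (A := mk X) (B := mk Y) S a b :=
  ⟨fun h _ _ _ => by rw [h], fun h => Hom.ext_holds h⟩

lemma id_holds {T : C} (a b : T ⟶ A) :
    Hom.Holds (A := mk A) (B := mk A) (𝟙 (mk A)) a b ↔ a = b :=
  (graph_holds (𝟙 A) a b).trans (by rw [Category.comp_id])

lemma unit_mul_holds {T : C} (a c : T ⟶ A) :
    Hom.Holds (A := mk A) (B := mk A) ((λ_ (mk A)).inv ≫ (η ▷ mk A) ≫ μ) a c ↔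
      ∃ (T' : C) (e : T' ⟶ T) (_ : StrongEpi e) (u : T' ⟶ A),
        IsId η u ∧ Mul μ u (e ≫ a) (e ≫ c) := by
  refine (graph_comp_holds (λ_ A).inv (Hom.comp (Hom.tensor η (graph (𝟙 A))) μ) a c).trans ?_
  have h : a ≫ (λ_ A).inv = lift (toUnit T) a := by ext; simp
  rw [h]
  refine (whiskerRight_comp_holds (X := 𝟙_ C) (Y := A) η μ (toUnit T) a c).trans ?_
  simp only [comp_toUnit]
  rfl

lemma mul_unit_holds {T : C} (a c : T ⟶ A) :
    Hom.Holds (A := mk A) (B := mk A) ((ρ_ (mk A)).inv ≫ (mk A ◁ η) ≫ μ) a c ↔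
      ∃ (T' : C) (e : T' ⟶ T) (_ : StrongEpi e) (u : T' ⟶ A),
        IsId η u ∧ Mul μ (e ≫ a) u (e ≫ c) := by
  refine (graph_comp_holds (ρ_ A).inv (Hom.comp (Hom.tensor (graph (𝟙 A)) η) μ) a c).trans ?_
  have h : a ≫ (ρ_ A).inv = lift a (toUnit T) := by ext; simp
  rw [h]
  refine (whiskerLeft_comp_holds (X := 𝟙_ C) (Y := A) η μ a (toUnit T) c).trans ?_
  simp only [comp_toUnit]
  rfl

lemma isUnital_iff : IsUnital μ η ↔
    (∀ (T : C) (a c : T ⟶ A), (∃ (T' : C) (e : T' ⟶ T) (_ : StrongEpi e) (u : T' ⟶ A),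
        IsId η u ∧ Mul μ u (e ≫ a) (e ≫ c)) ↔ a = c) ∧
    (∀ (T : C) (a c : T ⟶ A), (∃ (T' : C) (e : T' ⟶ T) (_ : StrongEpi e) (u : T' ⟶ A),
        IsId η u ∧ Mul μ (e ≫ a) u (e ≫ c)) ↔ a = c) := by
  have h₁ := hom_ext_iff (R := (λ_ (mk A)).inv ≫ (η ▷ mk A) ≫ μ) (S := 𝟙 (mk A))
  have h₂ := hom_ext_iff (R := (ρ_ (mk A)).inv ≫ (mk A ◁ η) ≫ μ) (S := 𝟙 (mk A))
  simp only [unit_mul_holds, mul_unit_holds, id_holds] at h₁ h₂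
  rw [← h₁, ← h₂]
  exact ⟨fun h => ⟨h.1, h.2⟩, fun h => ⟨h.1, h.2⟩⟩

lemma mul_mul_holds {T : C} (a b c d : T ⟶ A) :
    Hom.Holds (A := mk ((A ⊗ A) ⊗ A)) (B := mk A) ((μ ▷ mk A) ≫ μ) (lift (lift a b) c) d ↔
      ∃ (T' : C) (e : T' ⟶ T) (_ : StrongEpi e) (x : T' ⟶ A),
        Mul μ (e ≫ a) (e ≫ b) x ∧ Mul μ x (e ≫ c) (e ≫ d) := by
  refine (whiskerRight_comp_holds (X := A ⊗ A) (Y := A) μ μ (lift a b) c d).trans ?_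
  simp only [comp_lift]
  rfl

lemma mul_mul_holds' {T : C} (a b c d : T ⟶ A) :
    Hom.Holds (A := mk ((A ⊗ A) ⊗ A)) (B := mk A)
      ((α_ (mk A) (mk A) (mk A)).hom ≫ (mk A ◁ μ) ≫ μ) (lift (lift a b) c) d ↔
      ∃ (T' : C) (e : T' ⟶ T) (_ : StrongEpi e) (x : T' ⟶ A),
        Mul μ (e ≫ b) (e ≫ c) x ∧ Mul μ (e ≫ a) x (e ≫ d) := by
  refine (graph_comp_holds (α_ A A A).hom (Hom.comp (Hom.tensor (graph (𝟙 A)) μ) μ) _ d).trans ?_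
  rw [lift_lift_associator_hom]
  refine (whiskerLeft_comp_holds (X := A ⊗ A) (Y := A) μ μ a (lift b c) d).trans ?_
  simp only [comp_lift]
  rfl

lemma special_holds {T : C} (c d : T ⟶ A) :
    Hom.Holds (A := mk A) (B := mk A) (DaggerCategory.dagger μ ≫ μ) c d ↔
      ∃ (T' : C) (e : T' ⟶ T) (_ : StrongEpi e) (a b : T' ⟶ A),
        Mul μ a b (e ≫ c) ∧ Mul μ a b (e ≫ d) := by
  refine (comp_holds (Hom.dagger μ) μ c d).trans ?_
  refine exists_congr fun T' => exists_congr fun e => exists_congr fun he => ?_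
  constructor
  · rintro ⟨p, h₁, h₂⟩
    obtain ⟨a, b, rfl⟩ := exists_eq_lift (X := A) (Y := A) p
    exact ⟨a, b, (dagger_holds _ _ _).1 h₁, h₂⟩
  · rintro ⟨a, b, h₁, h₂⟩
    exact ⟨lift a b, (dagger_holds _ _ _).2 h₁, h₂⟩

/-- Splitting b as z w and multiplying a with z leaves w as second output; hence w is y, and z alone
stays existential. -/
lemma frobenius_left_holds {T : C} (a b x y : T ⟶ A) :
    Hom.Holds (A := mk (A ⊗ A)) (B := mk (A ⊗ A)) ((mk A ◁ DaggerCategory.dagger μ) ≫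
      (α_ (mk A) (mk A) (mk A)).inv ≫ (μ ▷ mk A)) (lift a b) (lift x y) ↔
      ∃ (T' : C) (e : T' ⟶ T) (_ : StrongEpi e) (z : T' ⟶ A),
        Mul μ z (e ≫ y) (e ≫ b) ∧ Mul μ (e ≫ a) z (e ≫ x) := by
  refine (whiskerLeft_comp_holds (X := A) (Y := A ⊗ A) (DaggerCategory.dagger μ) _ a b (lift x y)).trans ?_
  refine exists_congr fun T' => exists_congr fun e => exists_congr fun he => ?_
  have key : ∀ z w : T' ⟶ A, Hom.Holds (A := mk (A ⊗ A ⊗ A)) (B := mk (A ⊗ A))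
      ((α_ (mk A) (mk A) (mk A)).inv ≫ (μ ▷ mk A)) (lift (e ≫ a) (lift z w)) (e ≫ lift x y) ↔
      Mul μ (e ≫ a) z (e ≫ x) ∧ w = e ≫ y := by
    intro z w
    refine (graph_comp_holds (α_ A A A).inv (Hom.tensor μ (graph (𝟙 A))) _ _).trans
      ((tensor_holds _ _ _ _).trans ?_)
    rw [graph_holds]
    simp only [lift_lift_associator_inv, comp_lift, lift_fst, lift_snd, Category.comp_id]
    rfl
  constructor
  · rintro ⟨p, h₁, h₂⟩
    obtain ⟨z, w, rfl⟩ := exists_eq_lift (X := A) (Y := A) p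
    obtain ⟨h₃, rfl⟩ := (key z w).1 h₂
    exact ⟨z, (dagger_holds _ _ _).1 h₁, h₃⟩
  · rintro ⟨z, h₁, h₂⟩
    refine ⟨lift z (e ≫ y), (dagger_holds _ _ _).2 h₁, (key _ _).2 ⟨h₂, rfl⟩⟩

lemma frobenius_right_holds {T : C} (a b x y : T ⟶ A) :
    Hom.Holds (A := mk (A ⊗ A)) (B := mk (A ⊗ A)) ((DaggerCategory.dagger μ ▷ mk A) ≫
      (α_ (mk A) (mk A) (mk A)).hom ≫ (mk A ◁ μ)) (lift a b) (lift x y) ↔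
      ∃ (T' : C) (e : T' ⟶ T) (_ : StrongEpi e) (z : T' ⟶ A),
        Mul μ (e ≫ x) z (e ≫ a) ∧ Mul μ z (e ≫ b) (e ≫ y) := by
  refine (whiskerRight_comp_holds (X := A) (Y := A ⊗ A) (DaggerCategory.dagger μ) _ a b (lift x y)).trans ?_
  refine exists_congr fun T' => exists_congr fun e => exists_congr fun he => ?_
  have key : ∀ w z : T' ⟶ A, Hom.Holds (A := mk ((A ⊗ A) ⊗ A)) (B := mk (A ⊗ A))
      ((α_ (mk A) (mk A) (mk A)).hom ≫ (mk A ◁ μ)) (lift (lift w z) (e ≫ b)) (e ≫ lift x y) ↔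
      w = e ≫ x ∧ Mul μ z (e ≫ b) (e ≫ y) := by
    intro w z
    refine (graph_comp_holds (α_ A A A).hom (Hom.tensor (graph (𝟙 A)) μ) _ _).trans
      ((tensor_holds _ _ _ _).trans ?_)
    rw [graph_holds]
    simp only [lift_lift_associator_hom, comp_lift, lift_fst, lift_snd, Category.comp_id]
    rfl
  constructor
  · rintro ⟨p, h₁, h₂⟩
    obtain ⟨w, z, rfl⟩ := exists_eq_lift (X := A) (Y := A) p
    obtain ⟨rfl, h₃⟩ := (key w z).1 h₂
    exact ⟨z, (dagger_holds _ _ _).1 h₁, h₃⟩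
  · rintro ⟨z, h₁, h₂⟩
    refine ⟨lift (e ≫ x) z, (dagger_holds _ _ _).2 h₁, (key _ _).2 ⟨rfl, h₂⟩⟩

end RelCategory

/-! ### Difunctionality of the multiplication in each variable -/

namespace RelCategory

variable {C : Type u} [Category.{v} C] [CartesianMonoidalCategory C] [Regular C]
variable {A : C} {μ : mk A ⊗ mk A ⟶ mk A} {η : 𝟙_ (RelCategory C) ⟶ mk A} {T : C}

section Difunctional

lemma mul_difunctional_right (hC : IsMalcev C) {a b c a' b' c' : T ⟶ A} (h₁ : Mul μ a b c)
    (h₂ : Mul μ a' b' c) (h₃ : Mul μ a' b' c') : Mul μ a b c' := by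
  have := hC.difunctional (X := A ⊗ A) (Y := A) μ.sub (𝟙 _) (x := lift a b) (x' := lift a' b')
    (y := c) (y' := c')
  simp only [Category.comp_id] at this
  exact this h₁ h₂ h₃

lemma mul_difunctional_middle (hC : IsMalcev C) {a b c a' b' c' : T ⟶ A} (h₁ : Mul μ a b c)
    (h₂ : Mul μ a' b c') (h₃ : Mul μ a' b' c') : Mul μ a b' c := by
  have := hC.difunctional μ.sub (permMiddle A) (x := lift a c) (x' := lift a' c')
    (y := b) (y' := b')
  simp only [lift_permMiddle] at this
  exact this h₁ h₂ h₃

lemma mul_difunctional_left (hC : IsMalcev C) {a b c a' b' c' : T ⟶ A} (h₁ : Mul μ a b c)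
    (h₂ : Mul μ a b' c') (h₃ : Mul μ a' b' c') : Mul μ a' b c := by
  have := hC.difunctional μ.sub (permLeft A) (x := lift b c) (x' := lift b' c')
    (y := a) (y' := a')
  simp only [lift_permLeft] at this
  exact this h₁ h₂ h₃

end Difunctional

end RelCategory

/-! ### Cancellation, and existence without covers -/

namespace IsUnital

open RelCategory

variable {C : Type u} [Category.{v} C] [CartesianMonoidalCategory C] [Regular C]
variable {A : C} {μ : RelCategory.mk A ⊗ RelCategory.mk A ⟶ RelCategory.mk A} {η : 𝟙_ (RelCategory C) ⟶ RelCategory.mk A} {T : C}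

lemma eq_of_id_mul (h : IsUnital μ η) {u a c : T ⟶ A} (hu : IsId η u) (hm : Mul μ u a c) :
    a = c :=
  ((isUnital_iff.1 h).1 T a c).1 ⟨T, 𝟙 T, inferInstance, u, hu, by simpa using hm⟩

lemma eq_of_mul_id (h : IsUnital μ η) {u a c : T ⟶ A} (hu : IsId η u) (hm : Mul μ a u c) :
    a = c :=
  ((isUnital_iff.1 h).2 T a c).1 ⟨T, 𝟙 T, inferInstance, u, hu, by simpa using hm⟩

lemma exists_cover_id_mul (h : IsUnital μ η) (a : T ⟶ A) :
    ∃ (T' : C) (e : T' ⟶ T) (_ : StrongEpi e) (u : T' ⟶ A),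
      IsId η u ∧ Mul μ u (e ≫ a) (e ≫ a) :=
  ((isUnital_iff.1 h).1 T a a).2 rfl

lemma exists_cover_mul_id (h : IsUnital μ η) (a : T ⟶ A) :
    ∃ (T' : C) (e : T' ⟶ T) (_ : StrongEpi e) (u : T' ⟶ A),
      IsId η u ∧ Mul μ (e ≫ a) u (e ≫ a) :=
  ((isUnital_iff.1 h).2 T a a).2 rfl

/-- Locally v c' = c' for an identity v. Difunctionality along v c' = c', a b = c', a b = c gives v
c' = c, and the unit law gives c' = c. The two cancellation lemmas follow the same pattern. -/
lemma mul_unique (h : IsUnital μ η) (hC : IsMalcev C) {a b c c' : T ⟶ A} (h₁ : Mul μ a b c)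
    (h₂ : Mul μ a b c') : c = c' := by
  obtain ⟨T', e, he, v, hv, hm⟩ := h.exists_cover_id_mul c'
  have := StrongEpi.epi (f := e)
  rw [← cancel_epi e]
  exact (h.eq_of_id_mul hv (mul_difunctional_right hC hm (h₂.comp e) (h₁.comp e))).symm

lemma mul_left_cancel (h : IsUnital μ η) (hC : IsMalcev C) {a b b' c : T ⟶ A}
    (h₁ : Mul μ a b c) (h₂ : Mul μ a b' c) : b = b' := by
  obtain ⟨T', e, he, v, hv, hm⟩ := h.exists_cover_id_mul b'
  have := StrongEpi.epi (f := e)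
  rw [← cancel_epi e]
  exact h.eq_of_id_mul hv (mul_difunctional_middle hC hm (h₂.comp e) (h₁.comp e))

lemma mul_right_cancel (h : IsUnital μ η) (hC : IsMalcev C) {a a' b c : T ⟶ A}
    (h₁ : Mul μ a b c) (h₂ : Mul μ a' b c) : a = a' := by
  obtain ⟨T', e, he, v, hv, hm⟩ := h.exists_cover_mul_id a'
  have := StrongEpi.epi (f := e)
  rw [← cancel_epi e]
  exact h.eq_of_mul_id hv (mul_difunctional_left hC hm (h₂.comp e) (h₁.comp e))

/-- Products are unique, so unique choice makes a locally defined product global. The two factor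
versions use cancellation instead. -/
lemma exists_mul_of_cover (h : IsUnital μ η) (hC : IsMalcev C) {T' : C} (e : T' ⟶ T)
    [StrongEpi e] {a b : T ⟶ A} {c : T' ⟶ A} (hm : Mul μ (e ≫ a) (e ≫ b) c) :
    ∃ c, Mul μ a b c := by
  have := exists_factors_of_cover (X := A ⊗ A) (Y := A) μ.sub (𝟙 _) (lift a b)
    (y := c) (e := e)
  simp only [Category.comp_id, comp_lift] at this
  exact this (fun _ _ _ h₁ h₂ => h.mul_unique hC h₁ h₂) hm

lemma exists_right_factor_of_cover (h : IsUnital μ η) (hC : IsMalcev C) {T' : C} (e : T' ⟶ T)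
    [StrongEpi e] {a c : T ⟶ A} {b : T' ⟶ A} (hm : Mul μ (e ≫ a) b (e ≫ c)) :
    ∃ b, Mul μ a b c := by
  have := exists_factors_of_cover μ.sub (permMiddle A) (lift a c) (y := b) (e := e)
  simp only [comp_lift, lift_permMiddle] at this
  exact this (fun _ _ _ h₁ h₂ => h.mul_left_cancel hC h₁ h₂) hm

lemma exists_left_factor_of_cover (h : IsUnital μ η) (hC : IsMalcev C) {T' : C} (e : T' ⟶ T)
    [StrongEpi e] {b c : T ⟶ A} {a : T' ⟶ A} (hm : Mul μ a (e ≫ b) (e ≫ c)) :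
    ∃ a, Mul μ a b c := by
  have := exists_factors_of_cover μ.sub (permLeft A) (lift b c) (y := a) (e := e)
  simp only [comp_lift, lift_permLeft] at this
  exact this (fun _ _ _ h₁ h₂ => h.mul_right_cancel hC h₁ h₂) hm

lemma exists_mul_id (h : IsUnital μ η) (hC : IsMalcev C) (a : T ⟶ A) :
    ∃ u : T ⟶ A, IsId η u ∧ Mul μ a u a := by
  obtain ⟨T', e, he, u', hu', hm⟩ := h.exists_cover_mul_id a
  obtain ⟨u, hu⟩ := h.exists_right_factor_of_cover hC e hm
  -- By cancellation the global factor restricts on the cover to the local identity, and membership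
  -- in `η` descends.
  obtain rfl := h.mul_left_cancel hC hm (hu.comp e)
  exact ⟨u, hu'.of_cover e, hu⟩

lemma exists_id_mul (h : IsUnital μ η) (hC : IsMalcev C) (a : T ⟶ A) :
    ∃ u : T ⟶ A, IsId η u ∧ Mul μ u a a := by
  obtain ⟨T', e, he, u', hu', hm⟩ := h.exists_cover_id_mul a
  obtain ⟨u, hu⟩ := h.exists_left_factor_of_cover hC e hm
  obtain rfl := h.mul_right_cancel hC hm (hu.comp e)
  exact ⟨u, hu'.of_cover e, hu⟩

lemma id_mul_self (h : IsUnital μ η) (hC : IsMalcev C) {u : T ⟶ A} (hu : IsId η u) :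
    Mul μ u u u := by
  obtain ⟨v, hv, hm⟩ := h.exists_mul_id hC u
  obtain rfl := h.eq_of_id_mul hu hm
  exact hm

end IsUnital

/-! ### Images of the multiplication -/

namespace RelCategory

variable {C : Type u} [Category.{v} C] [CartesianMonoidalCategory C] [Regular C]
variable {A : C} {μ : mk A ⊗ mk A ⟶ mk A} {η : 𝟙_ (RelCategory C) ⟶ mk A} {T : C}

/-- Realises relations obtained by quantifying out a variable of `μ` as subobjects, to which
difunctionality applies. -/
lemma image_mul_factors {Z : C} (π : (A ⊗ A) ⊗ A ⟶ Z) (z : T ⟶ Z) :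
    (imageSubobject ((Hom.sub (A := mk (A ⊗ A)) (B := mk A) μ).arrow ≫ π)).Factors z ↔
      ∃ (T' : C) (e : T' ⟶ T) (_ : StrongEpi e) (a b c : T' ⟶ A),
        Mul μ a b c ∧ lift (lift a b) c ≫ π = e ≫ z := by
  rw [image_factors]
  refine exists_congr fun T' => exists_congr fun e => exists_congr fun he => ?_
  constructor
  · rintro ⟨f, hf⟩
    obtain ⟨p, c, hp⟩ := exists_eq_lift
      (f ≫ (Hom.sub (A := mk (A ⊗ A)) (B := mk A) μ).arrow)
    obtain ⟨a, b, rfl⟩ := exists_eq_lift p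
    refine ⟨a, b, c, ?_, ?_⟩
    · rw [Mul, Hom.Holds, ← hp]
      exact Subobject.factors_comp_arrow _
    · rw [← hp, ← hf, Category.assoc]
  · rintro ⟨a, b, c, h₁, h₂⟩
    refine ⟨(Hom.sub (A := mk (A ⊗ A)) (B := mk A) μ).factorThru _ h₁, ?_⟩
    rw [← h₂, ← Category.assoc]
    exact congrArg (· ≫ π) (Subobject.factorThru_arrow _ _ h₁)

end RelCategory

/-! ### Composability, inverses and associativity from the unit laws -/

namespace IsUnital

open RelCategory

variable {C : Type u} [Category.{v} C] [CartesianMonoidalCategory C] [Regular C]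
variable {A : C} {μ : RelCategory.mk A ⊗ RelCategory.mk A ⟶ RelCategory.mk A} {η : 𝟙_ (RelCategory C) ⟶ RelCategory.mk A} {T : C}

/-- The relation "`a` and `b` have a product" is difunctional. -/
lemma exists_mul_difunctional (h : IsUnital μ η) (hC : IsMalcev C) {a b a' b' : T ⟶ A}
    (h₁ : ∃ c, Mul μ a b c) (h₂ : ∃ c, Mul μ a' b c) (h₃ : ∃ c, Mul μ a' b' c) :
    ∃ c, Mul μ a b' c := by
  have key : ∀ a b : T ⟶ A, (imageSubobject ((Hom.sub (A := RelCategory.mk (A ⊗ A)) (B := RelCategory.mk A) μ).arrow ≫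
      fst _ _)).Factors (lift a b ≫ 𝟙 (A ⊗ A)) ↔ ∃ c, Mul μ a b c := by
    intro a b
    rw [Category.comp_id]
    refine (image_mul_factors (fst (A ⊗ A) A) _).trans ?_
    constructor
    · rintro ⟨T', e, he, x, y, c, hm, hp⟩
      rw [lift_fst, comp_lift] at hp
      obtain ⟨rfl, rfl⟩ : x = e ≫ a ∧ y = e ≫ b :=
        ⟨by simpa using congrArg (· ≫ fst _ _) hp, by simpa using congrArg (· ≫ snd _ _) hp⟩
      exact h.exists_mul_of_cover hC e hm
    · rintro ⟨c, hm⟩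
      exact ⟨T, 𝟙 T, inferInstance, a, b, c, hm, by simp⟩
  rw [← key] at h₁ h₂ h₃ ⊢
  exact hC.difunctional _ _ h₁ h₂ h₃

/-- The relation "`c` is a left multiple of `b`" is difunctional. -/
lemma exists_left_difunctional (h : IsUnital μ η) (hC : IsMalcev C) {b c b' c' : T ⟶ A}
    (h₁ : ∃ a, Mul μ a b c) (h₂ : ∃ a, Mul μ a b' c) (h₃ : ∃ a, Mul μ a b' c') :
    ∃ a, Mul μ a b c' := by
  have key : ∀ b c : T ⟶ A, (imageSubobject ((Hom.sub (A := RelCategory.mk (A ⊗ A)) (B := RelCategory.mk A) μ).arrow ≫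
      lift (fst _ _ ≫ snd _ _) (snd _ _))).Factors (lift b c ≫ 𝟙 (A ⊗ A)) ↔
      ∃ a, Mul μ a b c := by
    intro b c
    rw [Category.comp_id]
    refine (image_mul_factors (lift (fst (A ⊗ A) A ≫ snd _ _) (snd _ _)) _).trans ?_
    constructor
    · rintro ⟨T', e, he, a, x, y, hm, hp⟩
      simp only [comp_lift, lift_fst_assoc, lift_snd] at hp
      obtain ⟨rfl, rfl⟩ : x = e ≫ b ∧ y = e ≫ c :=
        ⟨by simpa using congrArg (· ≫ fst _ _) hp, by simpa using congrArg (· ≫ snd _ _) hp⟩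
      exact h.exists_left_factor_of_cover hC e hm
    · rintro ⟨a, hm⟩
      exact ⟨T, 𝟙 T, inferInstance, a, b, c, hm, by simp [comp_lift]⟩
  rw [← key] at h₁ h₂ h₃ ⊢
  exact hC.difunctional _ _ h₁ h₂ h₃

/-- The relation "`c` is a right multiple of `a`" is difunctional. -/
lemma exists_right_difunctional (h : IsUnital μ η) (hC : IsMalcev C) {a c a' c' : T ⟶ A}
    (h₁ : ∃ b, Mul μ a b c) (h₂ : ∃ b, Mul μ a' b c) (h₃ : ∃ b, Mul μ a' b c') :
    ∃ b, Mul μ a b c' := by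
  have key : ∀ a c : T ⟶ A, (imageSubobject ((Hom.sub (A := RelCategory.mk (A ⊗ A)) (B := RelCategory.mk A) μ).arrow ≫
      lift (fst _ _ ≫ fst _ _) (snd _ _))).Factors (lift a c ≫ 𝟙 (A ⊗ A)) ↔
      ∃ b, Mul μ a b c := by
    intro a c
    rw [Category.comp_id]
    refine (image_mul_factors (lift (fst (A ⊗ A) A ≫ fst _ _) (snd _ _)) _).trans ?_
    constructor
    · rintro ⟨T', e, he, x, b, y, hm, hp⟩
      simp only [comp_lift, lift_fst_assoc, lift_fst, lift_snd] at hp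
      obtain ⟨rfl, rfl⟩ : x = e ≫ a ∧ y = e ≫ c :=
        ⟨by simpa using congrArg (· ≫ fst _ _) hp, by simpa using congrArg (· ≫ snd _ _) hp⟩
      exact h.exists_right_factor_of_cover hC e hm
    · rintro ⟨b, hm⟩
      exact ⟨T, 𝟙 T, inferInstance, a, b, c, hm, by simp [comp_lift]⟩
  rw [← key] at h₁ h₂ h₃ ⊢
  exact hC.difunctional _ _ h₁ h₂ h₃

/-- A product `a b` exists exactly when the source of `a` is the target of `b`. -/
lemma exists_mul_iff (h : IsUnital μ η) (hC : IsMalcev C) {a b u v : T ⟶ A} (hu : IsId η u)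
    (hau : Mul μ a u a) (hv : IsId η v) (hvb : Mul μ v b b) : (∃ c, Mul μ a b c) ↔ u = v := by
  constructor
  · intro hab
    -- The composable pairs (v, b), (a, b), (a, u) make z = v u exist; as u and v are both
    -- identities, z equals each of them.
    obtain ⟨z, hz⟩ := h.exists_mul_difunctional hC ⟨_, hvb⟩ hab ⟨_, hau⟩
    exact (h.eq_of_id_mul hv hz).trans (h.eq_of_mul_id hu hz).symm
  · rintro rfl
    -- The pairs (a, u), (u, u), (u, b) are composable, hence so is (a, b).
    exact h.exists_mul_difunctional hC ⟨_, hau⟩ ⟨_, h.id_mul_self hC hu⟩ ⟨_, hvb⟩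

/-- From b to u via v b = b, b u = b, u u = u: b is a left multiple of b, b of u, and u of u, so u
is a left multiple of b. -/
lemma exists_left_inv (h : IsUnital μ η) (hC : IsMalcev C) {b u : T ⟶ A} (hu : IsId η u)
    (hbu : Mul μ b u b) : ∃ i, Mul μ i b u := by
  obtain ⟨v, -, hvb⟩ := h.exists_id_mul hC b
  exact h.exists_left_difunctional hC ⟨_, hvb⟩ ⟨_, hbu⟩ ⟨_, h.id_mul_self hC hu⟩

lemma exists_right_inv (h : IsUnital μ η) (hC : IsMalcev C) {a v : T ⟶ A} (hv : IsId η v)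
    (hva : Mul μ v a a) : ∃ i, Mul μ a i v := by
  obtain ⟨u, -, hau⟩ := h.exists_mul_id hC a
  exact h.exists_right_difunctional hC ⟨_, hau⟩ ⟨_, hva⟩ ⟨_, h.id_mul_self hC hv⟩

/-- The source of a product. -/
lemma source_mul (h : IsUnital μ η) (hC : IsMalcev C) {a b c u : T ⟶ A} (hm : Mul μ a b c)
    (hu : IsId η u) (hbu : Mul μ b u b) : Mul μ c u c := by
  obtain ⟨w, hw, hcw⟩ := h.exists_mul_id hC c
  obtain ⟨v, -, hvc⟩ := h.exists_id_mul hC c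
  -- Since c is a left multiple of c and of b, and u is one of b, also u is a left multiple of c.
  -- The same argument through c then writes w as d u; the unit laws give d = w and u = w.
  have hcu := h.exists_left_difunctional hC ⟨_, hvc⟩ ⟨_, hm⟩ (h.exists_left_inv hC hu hbu)
  obtain ⟨d, hd⟩ := h.exists_left_difunctional hC ⟨_, h.id_mul_self hC hu⟩ hcu
    (h.exists_left_inv hC hw hcw)
  obtain rfl := h.eq_of_mul_id hu hd
  obtain rfl := h.eq_of_id_mul hw hd
  exact hcw

/-- The target of a product. -/
lemma target_mul (h : IsUnital μ η) (hC : IsMalcev C) {a b c v : T ⟶ A} (hm : Mul μ a b c)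
    (hv : IsId η v) (hva : Mul μ v a a) : Mul μ v c c := by
  obtain ⟨w, hw, hwc⟩ := h.exists_id_mul hC c
  obtain ⟨u, -, hcu⟩ := h.exists_mul_id hC c
  have hcv := h.exists_right_difunctional hC ⟨_, hcu⟩ ⟨_, hm⟩ (h.exists_right_inv hC hv hva)
  obtain ⟨d, hd⟩ := h.exists_right_difunctional hC ⟨_, h.id_mul_self hC hv⟩ hcv
    (h.exists_right_inv hC hw hwc)
  obtain rfl := h.eq_of_id_mul hv hd
  obtain rfl := h.eq_of_mul_id hw hd
  exact hwc

lemma mul_mul_holds_iff (h : IsUnital μ η) (hC : IsMalcev C) (a b c d : T ⟶ A) :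
    Hom.Holds (A := RelCategory.mk ((A ⊗ A) ⊗ A)) (B := RelCategory.mk A) ((μ ▷ RelCategory.mk A) ≫ μ) (lift (lift a b) c) d ↔
      ∃ x, Mul μ a b x ∧ Mul μ x c d := by
  rw [mul_mul_holds]
  constructor
  · rintro ⟨T', e, he, x', h₁, h₂⟩
    obtain ⟨x, hx⟩ := h.exists_mul_of_cover hC e h₁
    obtain rfl := h.mul_unique hC h₁ (hx.comp e)
    exact ⟨x, hx, h₂.of_cover e⟩
  · rintro ⟨x, h₁, h₂⟩
    exact ⟨T, 𝟙 T, inferInstance, x, by simpa using h₁, by simpa using h₂⟩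

lemma mul_mul_holds_iff' (h : IsUnital μ η) (hC : IsMalcev C) (a b c d : T ⟶ A) :
    Hom.Holds (A := RelCategory.mk ((A ⊗ A) ⊗ A)) (B := RelCategory.mk A)
      ((α_ (RelCategory.mk A) (RelCategory.mk A) (RelCategory.mk A)).hom ≫ (RelCategory.mk A ◁ μ) ≫ μ) (lift (lift a b) c) d ↔
      ∃ x, Mul μ b c x ∧ Mul μ a x d := by
  rw [mul_mul_holds']
  constructor
  · rintro ⟨T', e, he, x', h₁, h₂⟩
    obtain ⟨x, hx⟩ := h.exists_mul_of_cover hC e h₁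
    obtain rfl := h.mul_unique hC h₁ (hx.comp e)
    exact ⟨x, hx, h₂.of_cover e⟩
  · rintro ⟨x, h₁, h₂⟩
    exact ⟨T, 𝟙 T, inferInstance, x, by simpa using h₁, by simpa using h₂⟩

/-- The relation "`(a b) c = a (b c)`" between `a` and `(b, c)` is difunctional. -/
lemma assoc_difunctional (h : IsUnital μ η) (hC : IsMalcev C) {a b c a' b' c' : T ⟶ A}
    (h₁ : ∃ x y d, Mul μ a b x ∧ Mul μ x c d ∧ Mul μ b c y ∧ Mul μ a y d)
    (h₂ : ∃ x y d, Mul μ a' b x ∧ Mul μ x c d ∧ Mul μ b c y ∧ Mul μ a' y d)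
    (h₃ : ∃ x y d, Mul μ a' b' x ∧ Mul μ x c' d ∧ Mul μ b' c' y ∧ Mul μ a' y d) :
    ∃ x y d, Mul μ a b' x ∧ Mul μ x c' d ∧ Mul μ b' c' y ∧ Mul μ a y d := by
  -- Two triples are related when the left bracketing of one and the right bracketing of the other
  -- have a common value. Pulling back along the diagonal puts the same triple on both sides.
  let R : Hom (RelCategory.mk ((A ⊗ A) ⊗ A)) (RelCategory.mk ((A ⊗ A) ⊗ A)) :=
    Hom.comp (B := RelCategory.mk A) ((μ ▷ RelCategory.mk A) ≫ μ) (Hom.dagger (A := RelCategory.mk ((A ⊗ A) ⊗ A))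
      ((α_ (RelCategory.mk A) (RelCategory.mk A) (RelCategory.mk A)).hom ≫ (RelCategory.mk A ◁ μ) ≫ μ))
  have key : ∀ a b c : T ⟶ A,
      R.sub.Factors (lift a (lift b c) ≫ lift (α_ A A A).inv (α_ A A A).inv) ↔
      ∃ x y d, Mul μ a b x ∧ Mul μ x c d ∧ Mul μ b c y ∧ Mul μ a y d := by
    intro a b c
    rw [comp_lift, lift_lift_associator_inv]
    refine (comp_holds _ _ (lift (lift a b) c) (lift (lift a b) c)).trans ?_
    simp only [dagger_holds, comp_lift]
    constructor
    · rintro ⟨T', e, he, d', h₁, h₂⟩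
      obtain ⟨x', hx', hd'⟩ := (h.mul_mul_holds_iff hC _ _ _ _).1 h₁
      obtain ⟨y', hy', hd''⟩ := (h.mul_mul_holds_iff' hC _ _ _ _).1 h₂
      obtain ⟨x, hx⟩ := h.exists_mul_of_cover hC e hx'
      obtain rfl := h.mul_unique hC hx' (hx.comp e)
      obtain ⟨y, hy⟩ := h.exists_mul_of_cover hC e hy'
      obtain rfl := h.mul_unique hC hy' (hy.comp e)
      obtain ⟨d, hd⟩ := h.exists_mul_of_cover hC e hd'
      obtain rfl := h.mul_unique hC hd' (hd.comp e)
      exact ⟨x, y, d, hx, hd, hy, hd''.of_cover e⟩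
    · rintro ⟨x, y, d, hx, hd, hy, hd'⟩
      exact ⟨T, 𝟙 T, inferInstance, d,
        (h.mul_mul_holds_iff hC _ _ _ _).2 ⟨x, by simpa using hx, by simpa using hd⟩,
        (h.mul_mul_holds_iff' hC _ _ _ _).2 ⟨y, by simpa using hy, by simpa using hd'⟩⟩
  rw [← key] at h₁ h₂ h₃ ⊢
  exact hC.difunctional _ _ h₁ h₂ h₃

/-- With u and v the source and target of b, associativity is immediate for (a, b, u), (v, b, u) and
(v, b, c), using the source of a b and the target of b c. Difunctionality between the first entry
and the other two reaches (a, b, c). -/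
lemma exists_assoc (h : IsUnital μ η) (hC : IsMalcev C) {a b c x y : T ⟶ A} (hx : Mul μ a b x)
    (hy : Mul μ b c y) : ∃ d, Mul μ x c d ∧ Mul μ a y d := by
  obtain ⟨u, hu, hbu⟩ := h.exists_mul_id hC b
  obtain ⟨v, hv, hvb⟩ := h.exists_id_mul hC b
  obtain ⟨x', y', d, h₁, h₂, h₃, h₄⟩ := h.assoc_difunctional hC
    ⟨x, b, x, hx, h.source_mul hC hx hu hbu, hbu, hx⟩ ⟨b, b, b, hvb, hbu, hbu, hvb⟩
    ⟨b, y, y, hvb, hy, hy, h.target_mul hC hy hv hvb⟩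
  obtain rfl := h.mul_unique hC hx h₁
  obtain rfl := h.mul_unique hC hy h₃
  exact ⟨d, h₂, h₄⟩

/-- A left inverse i and a right inverse j coincide: associativity of i b j equates u j = j with i v
= i. -/
lemma exists_inv (h : IsUnital μ η) (hC : IsMalcev C) {b u v : T ⟶ A} (hu : IsId η u)
    (hbu : Mul μ b u b) (hv : IsId η v) (hvb : Mul μ v b b) :
    ∃ i, Mul μ i b u ∧ Mul μ b i v := by
  obtain ⟨i, hi⟩ := h.exists_left_inv hC hu hbu
  obtain ⟨j, hj⟩ := h.exists_right_inv hC hv hvb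
  obtain ⟨d, h₁, h₂⟩ := h.exists_assoc hC hi hj
  obtain rfl := h.eq_of_id_mul hu h₁
  obtain rfl := h.eq_of_mul_id hv h₂
  exact ⟨i, hi, hj⟩

end IsUnital

/-! ### Internal categories as relations -/

namespace InternalCategory

open RelCategory

variable {C : Type u} [Category.{v} C] [CartesianMonoidalCategory C] [Regular C] {U A : C}
variable (G : InternalCategory U A) {T : C}

lemma mul_compRel (a b c : T ⟶ A) :
    Mul G.compRel a b c ↔ ∃ h : a ≫ G.s = b ≫ G.t, pullback.lift a b h ≫ G.m = c := by
  refine (ofSpan_holds (A := RelCategory.mk (A ⊗ A)) (B := RelCategory.mk A) _ _ _ _).trans ?_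
  constructor
  · rintro ⟨r, hr, rfl⟩
    rw [comp_lift] at hr
    have h₁ : r ≫ pullback.fst G.s G.t = a := by simpa using congrArg (· ≫ fst _ _) hr
    have h₂ : r ≫ pullback.snd G.s G.t = b := by simpa using congrArg (· ≫ snd _ _) hr
    subst h₁ h₂
    refine ⟨by rw [Category.assoc, Category.assoc, pullback.condition], ?_⟩
    congr 1
    apply pullback.hom_ext
    · rw [pullback.lift_fst]
    · rw [pullback.lift_snd]
  · rintro ⟨h, rfl⟩
    exact ⟨pullback.lift a b h, by rw [comp_lift, pullback.lift_fst, pullback.lift_snd], rfl⟩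

lemma isId_idRel (a : T ⟶ A) : IsId G.idRel a ↔ ∃ x : T ⟶ U, x ≫ G.u = a := by
  refine (ofSpan_holds (A := RelCategory.mk (𝟙_ C)) (B := RelCategory.mk A) _ _ _ _).trans ?_
  exact exists_congr fun x => and_iff_right (toUnit_unique _ _)

variable {G}

lemma mul_source (a : T ⟶ A) : Mul G.compRel a (a ≫ G.s ≫ G.u) a := by
  refine (G.mul_compRel _ _ _).2 ⟨by simp [G.u_t], ?_⟩
  have := congrArg (a ≫ ·) G.comp_id
  simp only [← Category.assoc, Category.comp_id] at this
  refine Eq.trans ?_ this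
  congr 1
  apply pullback.hom_ext <;> simp [pullback.lift_fst, pullback.lift_snd]

lemma target_mul (a : T ⟶ A) : Mul G.compRel (a ≫ G.t ≫ G.u) a a := by
  refine (G.mul_compRel _ _ _).2 ⟨by simp [G.u_s], ?_⟩
  have := congrArg (a ≫ ·) G.id_comp
  simp only [← Category.assoc, Category.comp_id] at this
  refine Eq.trans ?_ this
  congr 1
  apply pullback.hom_ext <;> simp [pullback.lift_fst, pullback.lift_snd]

lemma exists_mul_of_eq {a b : T ⟶ A} (h : a ≫ G.s = b ≫ G.t) : ∃ c, Mul G.compRel a b c :=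
  ⟨_, (G.mul_compRel _ _ _).2 ⟨h, rfl⟩⟩

lemma eq_of_mul {a b c : T ⟶ A} (h : Mul G.compRel a b c) : a ≫ G.s = b ≫ G.t :=
  ((G.mul_compRel _ _ _).1 h).1

lemma mul_compRel_unique {a b c c' : T ⟶ A} (h : Mul G.compRel a b c)
    (h' : Mul G.compRel a b c') : c = c' := by
  obtain ⟨_, rfl⟩ := (G.mul_compRel _ _ _).1 h
  obtain ⟨_, rfl⟩ := (G.mul_compRel _ _ _).1 h'
  rfl

lemma source_eq_of_mul {a b c : T ⟶ A} (h : Mul G.compRel a b c) : c ≫ G.s = b ≫ G.s := by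
  obtain ⟨_, rfl⟩ := (G.mul_compRel _ _ _).1 h
  rw [Category.assoc, G.m_s, pullback.lift_snd_assoc]

lemma target_eq_of_mul {a b c : T ⟶ A} (h : Mul G.compRel a b c) : c ≫ G.t = a ≫ G.t := by
  obtain ⟨_, rfl⟩ := (G.mul_compRel _ _ _).1 h
  rw [Category.assoc, G.m_t, pullback.lift_fst_assoc]

lemma mul_assoc_iff {a b c x y d : T ⟶ A} (hx : Mul G.compRel a b x) (hy : Mul G.compRel b c y) :
    Mul G.compRel x c d ↔ Mul G.compRel a y d := by
  have hab := eq_of_mul hx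
  have hbc := eq_of_mul hy
  obtain ⟨_, rfl⟩ := (G.mul_compRel _ _ _).1 hx
  obtain ⟨_, rfl⟩ := (G.mul_compRel _ _ _).1 hy
  rw [mul_compRel, mul_compRel]
  refine ⟨fun h => ⟨?_, (G.assoc a b c hab hbc).symm.trans h.2⟩,
    fun h => ⟨?_, (G.assoc a b c hab hbc).trans h.2⟩⟩
  · rw [Category.assoc, G.m_t, pullback.lift_fst_assoc, hab]
  · rw [Category.assoc, G.m_s, pullback.lift_snd_assoc, hbc]

/-- The composition and identities of an internal category satisfy the unit laws. -/
lemma isUnital (G : InternalCategory U A) : IsUnital G.compRel G.idRel := by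
  refine isUnital_iff.2 ⟨fun T a c => ⟨?_, ?_⟩, fun T a c => ⟨?_, ?_⟩⟩
  · rintro ⟨T', e, he, u, hu, hm⟩
    have := StrongEpi.epi (f := e)
    rw [← cancel_epi e]
    obtain ⟨x, rfl⟩ := (G.isId_idRel _).1 hu
    have hx := eq_of_mul hm
    rw [Category.assoc, G.u_s, Category.comp_id] at hx
    subst hx
    have := target_mul (G := G) (e ≫ a)
    rw [← Category.assoc] at this
    exact mul_compRel_unique this hm
  · rintro rfl
    exact ⟨T, 𝟙 T, inferInstance, a ≫ G.t ≫ G.u, (G.isId_idRel _).2 ⟨a ≫ G.t, by simp⟩,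
      by simpa using target_mul a⟩
  · rintro ⟨T', e, he, u, hu, hm⟩
    have := StrongEpi.epi (f := e)
    rw [← cancel_epi e]
    obtain ⟨x, rfl⟩ := (G.isId_idRel _).1 hu
    have hx := eq_of_mul hm
    rw [Category.assoc, Category.assoc, G.u_t, Category.comp_id] at hx
    subst hx
    have := mul_source (G := G) (e ≫ a)
    rw [Category.assoc, ← Category.assoc a, ← Category.assoc e] at this
    exact mul_compRel_unique this hm
  · rintro rfl
    exact ⟨T, 𝟙 T, inferInstance, a ≫ G.s ≫ G.u, (G.isId_idRel _).2 ⟨a ≫ G.s, by simp⟩,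
      by simpa using mul_source a⟩

/-- Composability is an equation of morphisms, so it descends along the epimorphism `e`; the
intermediate product then exists before covering. -/
lemma mul_of_cover_left {T' : C} (e : T' ⟶ T) [StrongEpi e] {a b c d : T ⟶ A} {x : T' ⟶ A}
    (h₁ : Mul G.compRel (e ≫ a) (e ≫ b) x) (h₂ : Mul G.compRel x (e ≫ c) (e ≫ d)) :
    ∃ x, Mul G.compRel a b x ∧ Mul G.compRel x c d := by
  have := StrongEpi.epi (f := e)
  have hab := eq_of_mul h₁
  rw [Category.assoc, Category.assoc, cancel_epi] at hab
  obtain ⟨y, hy⟩ := exists_mul_of_eq hab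
  obtain rfl := mul_compRel_unique h₁ (hy.comp e)
  exact ⟨y, hy, h₂.of_cover e⟩

lemma mul_of_cover_right {T' : C} (e : T' ⟶ T) [StrongEpi e] {a b c d : T ⟶ A} {x : T' ⟶ A}
    (h₁ : Mul G.compRel (e ≫ b) (e ≫ c) x) (h₂ : Mul G.compRel (e ≫ a) x (e ≫ d)) :
    ∃ x, Mul G.compRel b c x ∧ Mul G.compRel a x d := by
  have := StrongEpi.epi (f := e)
  have hbc := eq_of_mul h₁
  rw [Category.assoc, Category.assoc, cancel_epi] at hbc
  obtain ⟨y, hy⟩ := exists_mul_of_eq hbc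
  obtain rfl := mul_compRel_unique h₁ (hy.comp e)
  exact ⟨y, hy, h₂.of_cover e⟩

lemma compRel_mul_assoc (G : InternalCategory U A) :
    (G.compRel ▷ RelCategory.mk A) ≫ G.compRel =
      (α_ _ _ _).hom ≫ (RelCategory.mk A ◁ G.compRel) ≫ G.compRel := by
  refine (hom_ext_iff (X := (A ⊗ A) ⊗ A) (Y := A)).2 fun T p d => ?_
  obtain ⟨q, c, rfl⟩ := exists_eq_lift p
  obtain ⟨a, b, rfl⟩ := exists_eq_lift q
  refine (mul_mul_holds a b c d).trans (Iff.trans ?_ (mul_mul_holds' a b c d).symm)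
  constructor
  · rintro ⟨T', e, he, x, h₁, h₂⟩
    obtain ⟨x, h₁, h₂⟩ := mul_of_cover_left e h₁ h₂
    obtain ⟨y, hy⟩ := exists_mul_of_eq ((source_eq_of_mul h₁).symm.trans (eq_of_mul h₂))
    exact ⟨T, 𝟙 T, inferInstance, y, by simpa using hy,
      by simpa using (mul_assoc_iff h₁ hy).1 h₂⟩
  · rintro ⟨T', e, he, y, h₁, h₂⟩
    obtain ⟨y, h₁, h₂⟩ := mul_of_cover_right e h₁ h₂
    obtain ⟨x, hx⟩ := exists_mul_of_eq ((eq_of_mul h₂).trans (target_eq_of_mul h₁))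
    exact ⟨T, 𝟙 T, inferInstance, x, by simpa using hx,
      by simpa using (mul_assoc_iff hx h₁).2 h₂⟩

lemma compRel_special (G : InternalCategory U A) :
    DaggerCategory.dagger G.compRel ≫ G.compRel = 𝟙 (RelCategory.mk A) := by
  refine (hom_ext_iff (X := A) (Y := A)).2 fun T c d => ?_
  refine (special_holds c d).trans (Iff.trans ?_ (id_holds c d).symm)
  constructor
  · rintro ⟨T', e, he, a, b, h₁, h₂⟩
    have := StrongEpi.epi (f := e)
    rw [← cancel_epi e]
    exact mul_compRel_unique h₁ h₂
  · rintro rfl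
    -- Every arrow is a product, namely of itself with its source identity.
    exact ⟨T, 𝟙 T, inferInstance, c, c ≫ G.s ≫ G.u, by simpa using mul_source c,
      by simpa using mul_source c⟩

end InternalCategory

/-! ### The Frobenius law for internal groupoids -/

namespace InternalGroupoid

open RelCategory InternalCategory

variable {C : Type u} [Category.{v} C] [CartesianMonoidalCategory C] [Regular C] {U A : C}
variable (G : InternalGroupoid U A) {T : C}

lemma mul_inv (a : T ⟶ A) : Mul G.compRel a (a ≫ G.i) (a ≫ G.t ≫ G.u) := by
  refine (G.mul_compRel _ _ _).2 ⟨by rw [Category.assoc, G.i_t], ?_⟩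
  rw [← G.comp_inv]
  refine Eq.trans ?_ (Category.assoc _ _ _)
  congr 1
  apply pullback.hom_ext <;> simp [pullback.lift_fst, pullback.lift_snd]

lemma inv_mul (a : T ⟶ A) : Mul G.compRel (a ≫ G.i) a (a ≫ G.s ≫ G.u) := by
  refine (G.mul_compRel _ _ _).2 ⟨by rw [Category.assoc, G.i_s], ?_⟩
  rw [← G.inv_comp]
  refine Eq.trans ?_ (Category.assoc _ _ _)
  congr 1
  apply pullback.hom_ext <;> simp [pullback.lift_fst, pullback.lift_snd]

/-- The composition of an internal groupoid satisfies the Frobenius law. -/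
lemma frobenius : (RelCategory.mk A ◁ DaggerCategory.dagger G.compRel) ≫ (α_ _ _ _).inv ≫
      (G.compRel ▷ RelCategory.mk A) =
    (DaggerCategory.dagger G.compRel ▷ RelCategory.mk A) ≫ (α_ _ _ _).hom ≫
      (RelCategory.mk A ◁ G.compRel) := by
  refine (hom_ext_iff (X := A ⊗ A) (Y := A ⊗ A)).2 fun T p q => ?_
  obtain ⟨a, b, rfl⟩ := exists_eq_lift p
  obtain ⟨x, y, rfl⟩ := exists_eq_lift q
  refine (frobenius_left_holds a b x y).trans (Iff.trans ?_ (frobenius_right_holds a b x y).symm)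
  refine exists_congr fun T' => exists_congr fun e => exists_congr fun he => ?_
  constructor
  · rintro ⟨z, h₁, h₂⟩
    -- From z y = b and a z = x, the inverse of z satisfies x z⁻¹ = a and z⁻¹ b = y. The converse
    -- direction also inverts z, and no further cover is needed.
    refine ⟨z ≫ G.i, ?_, ?_⟩
    · refine (mul_assoc_iff h₂ (G.mul_inv z)).2 ?_
      have := mul_source (G := G.toInternalCategory) (e ≫ a)
      rwa [← Category.assoc, eq_of_mul h₂, Category.assoc] at this
    · refine (mul_assoc_iff (G.inv_mul z) h₁).1 ?_
      have := target_mul (G := G.toInternalCategory) (e ≫ y)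
      rwa [← Category.assoc, ← eq_of_mul h₁, Category.assoc] at this
  · rintro ⟨z, h₁, h₂⟩
    refine ⟨z ≫ G.i, ?_, ?_⟩
    · refine (mul_assoc_iff (G.inv_mul z) h₂).1 ?_
      have := target_mul (G := G.toInternalCategory) (e ≫ b)
      rwa [← Category.assoc, ← eq_of_mul h₂, Category.assoc] at this
    · refine (mul_assoc_iff h₁ (G.mul_inv z)).2 ?_
      have := mul_source (G := G.toInternalCategory) (e ≫ x)
      rwa [← Category.assoc, eq_of_mul h₁, Category.assoc] at this

/-- An internal groupoid is a special dagger Frobenius structure in the category of relations. -/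
lemma isSpecialDaggerFrobenius : IsSpecialDaggerFrobenius G.compRel G.idRel where
  toIsUnital := G.isUnital
  mul_assoc := G.compRel_mul_assoc
  special := G.compRel_special
  frobenius := G.frobenius

end InternalGroupoid

/-! ### Construction of the internal groupoid -/

namespace IsUnital

open RelCategory

variable {C : Type u} [Category.{v} C] [CartesianMonoidalCategory C] [Regular C] {A : C}
  {μ : RelCategory.mk A ⊗ RelCategory.mk A ⟶ RelCategory.mk A}
  {η : 𝟙_ (RelCategory C) ⟶ RelCategory.mk A}

/-- In a regular Mal'cev category, relations satisfying the unit laws are the composition and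
identities of an internal groupoid. -/
theorem exists_internalGroupoid (h : IsUnital μ η) (hC : IsMalcev C) :
    ∃ (U : C) (G : InternalGroupoid U A), G.compRel = μ ∧ G.idRel = η := by
  obtain ⟨U, ι, hι, hη⟩ : ∃ (U : C) (ι : U ⟶ A) (_ : Mono ι), ∀ {T : C} (a : T ⟶ A),
      IsId η a ↔ ∃ x : T ⟶ U, x ≫ ι = a := by
    let S := Hom.sub (A := RelCategory.mk (𝟙_ C)) (B := RelCategory.mk A) η
    -- The first factor is terminal, so projecting away from it keeps the inclusion of `η` monic;
    -- its domain is the object of objects.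
    refine ⟨(S : C), S.arrow ≫ snd (𝟙_ C) A, ⟨fun f g hfg => ?_⟩, fun {T} a => ⟨?_, ?_⟩⟩
    · rw [← cancel_mono S.arrow]
      refine CartesianMonoidalCategory.hom_ext _ _ (toUnit_unique _ _) ?_
      rw [Category.assoc, Category.assoc]
      exact hfg
    · intro ha
      refine ⟨S.factorThru _ ha, ?_⟩
      have : S.factorThru _ ha ≫ S.arrow = lift (toUnit T) a := Subobject.factorThru_arrow _ _ ha
      rw [reassoc_of% this, lift_snd]
    · rintro ⟨x, rfl⟩
      have : lift (toUnit T) (x ≫ S.arrow ≫ snd (𝟙_ C) A) = x ≫ S.arrow :=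
        CartesianMonoidalCategory.hom_ext _ _ (toUnit_unique _ _) (by simp)
      change S.Factors (lift (toUnit T) _)
      rw [this]
      exact Subobject.factors_comp_arrow _
  have hid : ∀ {T : C} (x : T ⟶ U), IsId η (x ≫ ι) := fun x => (hη _).2 ⟨x, rfl⟩
  -- Source, target and inverse are taken at the generic element `𝟙 A`; precomposition gives them at
  -- every other element.
  obtain ⟨s₀, hs₀, hs⟩ := h.exists_mul_id hC (𝟙 A)
  obtain ⟨s, rfl⟩ := (hη _).1 hs₀
  obtain ⟨t₀, ht₀, ht⟩ := h.exists_id_mul hC (𝟙 A)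
  obtain ⟨t, rfl⟩ := (hη _).1 ht₀
  obtain ⟨i, hi, hi'⟩ := h.exists_inv hC (hid s) hs (hid t) ht
  have hs' : ∀ {T : C} (a : T ⟶ A), Mul μ a ((a ≫ s) ≫ ι) a := fun a => by simpa using hs.comp a
  have ht' : ∀ {T : C} (a : T ⟶ A), Mul μ ((a ≫ t) ≫ ι) a a := fun a => by simpa using ht.comp a
  have hcomp : ∀ {T : C} (a b : T ⟶ A), (∃ c, Mul μ a b c) ↔ a ≫ s = b ≫ t := fun a b => by
    rw [h.exists_mul_iff hC (hid _) (hs' a) (hid _) (ht' b), cancel_mono]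
  have hms : ∀ {T : C} {a b c : T ⟶ A}, Mul μ a b c → c ≫ s = b ≫ s := fun {T a b c} hm => by
    rw [← cancel_mono ι]
    exact h.mul_left_cancel hC (hs' c) (h.source_mul hC hm (hid _) (hs' b))
  have hmt : ∀ {T : C} {a b c : T ⟶ A}, Mul μ a b c → c ≫ t = a ≫ t := fun {T a b c} hm => by
    rw [← cancel_mono ι]
    exact h.mul_right_cancel hC (ht' c) (h.target_mul hC hm (hid _) (ht' a))
  have hus : ι ≫ s = 𝟙 U := by
    rw [← cancel_mono ι, Category.id_comp]
    exact h.eq_of_id_mul (by simpa using hid (𝟙 U)) (hs' ι)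
  have hut : ι ≫ t = 𝟙 U := by
    rw [← cancel_mono ι, Category.id_comp]
    exact h.eq_of_mul_id (by simpa using hid (𝟙 U)) (ht' ι)
  -- The two pullback projections are the generic composable pair, and `m` is their product.
  obtain ⟨m, hm⟩ := (hcomp _ _).2 (pullback.condition (f := s) (g := t))
  have hm' : ∀ {T : C} (a b : T ⟶ A) (w : a ≫ s = b ≫ t), Mul μ a b (pullback.lift a b w ≫ m) :=
    fun a b w => by
      have := hm.comp (pullback.lift a b w)
      rwa [pullback.lift_fst, pullback.lift_snd] at this
  have his : i ≫ s = t := by simpa [hut] using ((hcomp _ _).1 ⟨_, hi⟩)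
  have hit : i ≫ t = s := by simpa [hus] using ((hcomp _ _).1 ⟨_, hi'⟩).symm
  let G : InternalGroupoid U A :=
    { s := s
      t := t
      u := ι
      m := m
      u_s := hus
      u_t := hut
      m_s := hms hm
      m_t := hmt hm
      comp_id := h.mul_unique hC (hm' _ _ _) hs
      id_comp := h.mul_unique hC (hm' _ _ _) ht
      assoc := fun a b c hab hbc => by
        obtain ⟨d, h₁, h₂⟩ := h.exists_assoc hC (hm' a b hab) (hm' b c hbc)
        rw [h.mul_unique hC (hm' _ _ _) h₁, h.mul_unique hC (hm' _ _ _) h₂]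
      i := i
      i_s := his
      i_t := hit
      comp_inv := h.mul_unique hC (hm' _ _ _) hi'
      inv_comp := h.mul_unique hC (hm' _ _ _) hi }
  refine ⟨U, G, Mul.ext fun T a b c => ?_, IsId.ext fun T a => ?_⟩
  · rw [InternalCategory.mul_compRel]
    constructor
    · rintro ⟨w, rfl⟩
      exact hm' a b w
    · intro habc
      have w := (hcomp _ _).1 ⟨_, habc⟩
      exact ⟨w, h.mul_unique hC (hm' a b w) habc⟩
  · rw [InternalCategory.isId_idRel, hη]

end IsUnital

/-- In a regular Mal'cev category `C`, for relations `μ : A ⊗ A ⟶ A` and `η : I ⟶ A`, the unit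
laws alone are equivalent to `μ` and `η` being the composition and identities of an internal
category, or of an internal groupoid, in `C`, and to `(A, μ, η)` being a special dagger Frobenius
structure in the category of relations. -/
theorem mainTheorem3 {C : Type u} [Category.{v} C] [CartesianMonoidalCategory C] [Regular C]
    (hC : IsMalcev C) {A : C}
    (μ : RelCategory.mk A ⊗ RelCategory.mk A ⟶ RelCategory.mk A)
    (η : 𝟙_ (RelCategory C) ⟶ RelCategory.mk A) :
    List.TFAE [
      IsUnital μ η,
      ∃ (U : C) (G : InternalCategory U A), G.compRel = μ ∧ G.idRel = η,
      ∃ (U : C) (G : InternalGroupoid U A), G.compRel = μ ∧ G.idRel = η,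
      IsSpecialDaggerFrobenius μ η] := by
  -- Only this implication uses the Mal'cev condition.
  tfae_have 1 → 3 := fun h => h.exists_internalGroupoid hC
  tfae_have 3 → 2 := by
    rintro ⟨U, G, hμ, hη⟩
    exact ⟨U, G.toInternalCategory, hμ, hη⟩
  tfae_have 2 → 1 := by
    rintro ⟨U, G, rfl, rfl⟩
    exact G.isUnital
  tfae_have 3 → 4 := by
    rintro ⟨U, G, rfl, rfl⟩
    exact G.isSpecialDaggerFrobenius
  tfae_have 4 → 1 := fun h => h.toIsUnital
  tfae_finish
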